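/- **Conventions.** Graded vector spaces $V=\bigoplus_{d\in\mathbb Z}V^d$ are real, of arbitrary dimension; all multilinear identities are stated on homogeneous elements, $|x|$ is the degree of $x$ in $V$, $\varepsilon(\sigma;x)$ is the Koszul sign of a permutation and $\chi(\sigma;x)=\operatorname{sgn}(\sigma)\varepsilon(\sigma;x)$. An $L_\infty$-algebra $(V,\mu_n)$ consists of graded-antisymmetric $n$-linear brackets $\mu_n$, $n\ge1$, of degree $2-n$ with $$\sum_{i+j=n}\ \sum_{\sigma\in\mathrm{Sh}(i,j)}(-1)^j\chi(\sigma;x)\,\mu_{j+1}\big(\mu_i(x_{\sigma(1)},\dots,x_{\sigma(i)}),x_{\sigma(i+1)},\dots,x_{\sigma(n)}\big)=0 .$$ A morphism $\pi\colon(V,\mu_n)\to(V_\partial,\mu^\partial_n)$ consists of graded-antisymmetric $\pi_n\colon V^{n}\to V_\partial$, $n\ge1$, of degree $1-n$ with $$\sum_{i+j=n}\ \sum_{\sigma\in\mathrm{Sh}(i,j)}(-1)^j\chi(\sigma;x)\,\pi_{j+1}\big(\mu_i(x_{\sigma(1)},\dots),\dots,x_{\sigma(n)}\big)=\sum_{k}\frac1{k!}\sum_{i_1+\dots+i_k=n}\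 \sum_{\sigma\in\mathrm{Sh}(i_1,\dots,i_k)}(-1)^{\zeta}\chi(\sigma;x)\,\mu^\partial_k\big(\pi_{i_1}(x_{\sigma(1)},\dots),\dots,\pi_{i_k}(\dots,x_{\sigma(n)})\big),$$ where $\zeta=\sum_m(i_m-1)\sum_{r\le i_1+\dots+i_{m-1}}(|x_{\sigma(r)}|-1)$. A *cyclic relative $L_\infty$-algebra* $\pi\colon(V,\mu_n,\langle-,-\rangle_V)\to(V_\partial,\mu^\partial_n,\langle-,-\rangle_{V_\partial})$ is such a morphism with a non-degenerate graded-symmetric bilinear form $\langle-,-\rangle_V$ of degree $-3$ on $V$ and a bilinear form $\langle-,-\rangle_{V_\partial}$ of degree $-2$ on $V_\partial$ (with no symmetry, possibly degenerate), such that for every $n$ the maps $$[x_1,\dots,x_n]_V=\langle x_1,\mu_{n-1}(x_2,\dots,x_n)\rangle_V+\sum_{i+j=n,\ i,j\ge1}(-1)^{(n-1)(|x_1|-1)+(j-1)\sum_{r\le i}(|x_r|-1)}\langle\pi_i(x_1,\dots,x_i),\pi_j(x_{i+1},\dots,x_n)\rangle_{V_\partial},$$ $$[[x_1,\dots,x_n]]_{V_\partial}=\langle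 x_1,\mu^\partial_{n-1}(x_2,\dots,x_n)\rangle_{V_\partial}+(-1)^{|x_1||\mu^\partial_{n-1}(x_2,\dots,x_n)|}\langle\mu^\partial_{n-1}(x_2,\dots,x_n),x_1\rangle_{V_\partial}$$ are cyclic: $F(x_1,\dots,x_n)=(-1)^{n-1+(n-1)(|x_1|+|x_n|)+|x_n|\sum_{i<n}|x_i|}F(x_n,x_1,\dots,x_{n-1})$. For a graded vector space $W$ consider the formal graded manifold modelled on $W$: vector fields, origin-preserving maps and two-forms are given by their Taylor coefficients at the origin, i.e. by graded-symmetric multilinear maps in the base point (for a two-form, in addition graded-antisymmetric in two tangent vectors). A *BV–BFV pair* $(X,Q,\omega)\xrightarrow{\Pi}(X_\partial,Q_\partial,\omega_\partial)$ consists of degree-one vector fields $Q$, $Q_\partial$ with $Q^2=0=Q_\partial^2$, a morphism $\Pi\colon X\to X_\partial$ relating $Q$ to $Q_\partial$, and closed two-forms $\omega$, $\omega_\partial$ with $\mathcal L_Q\omega+\Pi^*\omega_\partial=0$ and $\mathcal L_{Q_\partial}\omega_\partial=0$. The Lie derivative is that of the left action of $Q$; for a constant two-form $\omega$ of degree $k$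 its value at the origin is $(\mathcal L_Q\omega)(v,w)=(-1)^{k}\big(\omega(Q_1v,w)+(-1)^{|v|_W}\omega(v,Q_1w)\big)$, where $|v|_W$ is the degree of $v$ in $W$. **Proposition.** Let $\pi\colon(V,\mu_n,\langle-,-\rangle_V)\to(V_\partial,\mu^\partial_n,\langle-,-\rangle_{V_\partial})$ be a cyclic relative $L_\infty$-algebra. Then there is a BV–BFV pair $$(V[1],Q,\omega)\xrightarrow{\ \Pi\ }(V_\partial[1],Q_\partial,\omega_\partial)$$ with the following Taylor coefficients, where $V[1]^d=V^{d+1}$ and elements of $V[1]$ are identified with elements of $V$: $$Q_n(x_1,\dots,x_n)=-(-1)^{\sum_k(n-k)(|x_k|-1)}\mu_n(x_1,\dots,x_n),\qquad \Pi_n(x_1,\dots,x_n)=(-1)^{\sum_k(n-k)(|x_k|-1)}\pi_n(x_1,\dots,x_n),$$ $Q_\partial$ is given by $\mu^\partial_n$ in the same way, and $\omega$, $\omega_\partial$ are the constant two-forms of degrees $-1$ and $0$ $$\omega(x,y)=(-1)^{|x|}\langle x,y\rangle_V,\qquad \omega_\partial(x,y)=(-1)^{|x|}\big(\langle x,y\rangle_{V_\partial}+(-1)^{|x||y|}\langle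 y,x\rangle_{V_\partial}\big).$$ -/

import Mathlib

namespace RelLInfty

open scoped Nat
open Equiv (Perm)

/-! ### Graded multilinear algebra

A graded real vector space is a real vector space `V` with a family `𝒱 : ℤ → Submodule ℝ V` of
homogeneous parts and a decomposition `V = ⨁ d, 𝒱 d` (algebraic direct sum, arbitrary dimension).
Identities with Koszul signs are stated on homogeneous elements, which determine multilinear maps. -/

/-- The sign `(-1)^k`. -/
noncomputable def sgn (k : ℤ) : ℝ := (-1 : ℝ) ^ k

/-- `n`-linear maps from `V` to `M` over `ℝ`. -/
abbrev Multi (n : ℕ) (V M : Type*) [AddCommGroup V] [Module ℝ V] [AddCommGroup M] [Module ℝ M] :=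
  MultilinearMap ℝ (fun _ : Fin n => V) M

/-- The Koszul sign `ε(σ; d)`, defined by `x₁ ⋯ xₙ = ε(σ; d) x_{σ(1)} ⋯ x_{σ(n)}` for
graded-commuting variables `x_k` of degree `d k`: a factor `(-1)^{|x||y|}` for each inversion. -/
noncomputable def koszul {n : ℕ} (d : Fin n → ℤ) (σ : Perm (Fin n)) : ℝ :=
  ∏ i : Fin n, ∏ j : Fin n, if i < j ∧ σ j < σ i then sgn (d (σ i) * d (σ j)) else 1

/-- The antisymmetric Koszul sign `χ(σ; d) = sign(σ) ε(σ; d)`. -/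
noncomputable def koszulAnti {n : ℕ} (d : Fin n → ℤ) (σ : Perm (Fin n)) : ℝ :=
  ((Perm.sign σ : ℤ) : ℝ) * koszul d σ

/-- The first `i` entries of an `n`-tuple. -/
def firstPart {α : Type*} {n : ℕ} (x : Fin n → α) (i : Fin (n + 1)) : Fin (i : ℕ) → α :=
  fun k => x ⟨k, by omega⟩

/-- The last `n - i` entries of an `n`-tuple. -/
def lastPart {α : Type*} {n : ℕ} (x : Fin n → α) (i : Fin (n + 1)) : Fin (n - (i : ℕ)) → α :=
  fun k => x ⟨(i : ℕ) + k, by omega⟩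

section Graded

variable {V U : Type*} [AddCommGroup V] [Module ℝ V] [AddCommGroup U] [Module ℝ U]

/-- The degree shift `V[1]`, with `V[1]^d = V^{d+1}`: the element `[1] ⊗ x` is `x` itself, its degree
is `|x| - 1`. -/
def shift (𝒱 : ℤ → Submodule ℝ V) : ℤ → Submodule ℝ V := fun d => 𝒱 (d + 1)

/-- `x` is a tuple of homogeneous elements of degrees `d`. -/
def Homog (𝒱 : ℤ → Submodule ℝ V) {n : ℕ} (d : Fin n → ℤ) (x : Fin n → V) : Prop :=
  ∀ k, x k ∈ 𝒱 (d k)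

/-- The multilinear map `f` has degree `k`. -/
def HasDegree (𝒱 : ℤ → Submodule ℝ V) (𝒰 : ℤ → Submodule ℝ U) (k : ℤ) {n : ℕ}
    (f : Multi n V U) : Prop :=
  ∀ d x, Homog 𝒱 d x → f x ∈ 𝒰 (∑ j, d j + k)

def GradedSymmetric (𝒱 : ℤ → Submodule ℝ V) {n : ℕ} (f : Multi n V U) : Prop :=
  ∀ d x, Homog 𝒱 d x → ∀ σ : Perm (Fin n), f x = koszul d σ • f (x ∘ σ)

def GradedAntisymmetric (𝒱 : ℤ → Submodule ℝ V) {n : ℕ} (f : Multi n V U) : Prop :=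
  ∀ d x, Homog 𝒱 d x → ∀ σ : Perm (Fin n), f x = koszulAnti d σ • f (x ∘ σ)

/-- The bilinear form `b` has degree `k` as a map to `ℝ` (which sits in degree `0`). -/
def FormHasDegree (𝒱 : ℤ → Submodule ℝ V) (k : ℤ) (b : V →ₗ[ℝ] V →ₗ[ℝ] ℝ) : Prop :=
  ∀ d e x y, x ∈ 𝒱 d → y ∈ 𝒱 e → d + e + k ≠ 0 → b x y = 0

end Graded

/-! ### `L_∞`-algebras, their morphisms, and cyclic structures

Sums over `(i, n - i)`-unshuffles of graded (anti)symmetric expressions are written as sums over all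
permutations, weighted by `1 / (i! (n - i)!)`; similarly for more than two blocks. -/

section LInfty

variable {V V' : Type*} [AddCommGroup V] [Module ℝ V] [AddCommGroup V'] [Module ℝ V']

/-- An `L_∞`-algebra structure on a graded vector space: graded antisymmetric brackets
`μ_n`, `n ≥ 1`, of degree `2 - n` (and `μ_0 = 0`), with the homotopy Jacobi identities
`∑_{i+j=n} ∑_σ (-1)^j χ(σ; x) μ_{j+1}(μ_i(x_{σ(1)}, …, x_{σ(i)}), x_{σ(i+1)}, …, x_{σ(n)}) = 0`. -/
structure LInfinityAlgebra (𝒱 : ℤ → Submodule ℝ V) where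
  μ : ∀ n : ℕ, Multi n V V
  μ_zero : μ 0 = 0
  degree : ∀ n : ℕ, HasDegree 𝒱 𝒱 (2 - n) (μ n)
  antisymm : ∀ n : ℕ, GradedAntisymmetric 𝒱 (μ n)
  jacobi : ∀ (n : ℕ) (d : Fin n → ℤ) (x : Fin n → V), Homog 𝒱 d x →
    ∑ i : Fin (n + 1), ∑ σ : Perm (Fin n),
      (sgn ((n : ℤ) - i) * koszulAnti d σ / (((i : ℕ)! : ℝ) * ((n - (i : ℕ))! : ℝ))) •
        μ (n - i + 1)
          (Fin.cons (μ i (firstPart (x ∘ σ) i)) (lastPart (x ∘ σ) i) : Fin (n - i + 1) → V) = 0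

/-- The exponent of the sign in the definition of an `L_∞`-morphism, for arguments of degrees `d`
cut into consecutive blocks of lengths `i_1, …, i_k`: the sum over the blocks `m` of `i_m - 1` times
the total shifted degree of the arguments in the blocks before the `m`-th one. It is congruent
modulo `2` to
`∑_{m<m'} i_m i_{m'} + ∑_m i_m (k-m) + ∑_{m ≥ 2} (1 - i_m) ∑_{r ≤ i_1+⋯+i_{m-1}} |x_r|`. -/
def blockExponent {n : ℕ} (c : Composition n) (d : Fin n → ℤ) : ℤ :=
  ∑ m : Fin c.length, ((c.blocksFun m : ℤ) - 1) *
    ∑ r : Fin n, if (r : ℕ) < c.sizeUpTo m then d r - 1 else 0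

/-- A morphism of `L_∞`-algebras: graded antisymmetric maps `π_n`, `n ≥ 1`, of degree `1 - n`
(and `π_0 = 0`), with
`∑_{i+j=n} ∑_σ (-1)^j χ(σ; x) π_{j+1}(μ_i(x_{σ(1)}, …, x_{σ(i)}), x_{σ(i+1)}, …, x_{σ(n)})
= ∑_k 1/k! ∑_{i_1+⋯+i_k=n} ∑_σ (-1)^{blockExponent} χ(σ; x)
    μ'_k(π_{i_1}(x_{σ(1)}, …, x_{σ(i_1)}), …, π_{i_k}(…, x_{σ(n)}))`. -/
structure LInfinityMorphism {𝒱 : ℤ → Submodule ℝ V} {𝒱' : ℤ → Submodule ℝ V'}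
    (L : LInfinityAlgebra 𝒱) (L' : LInfinityAlgebra 𝒱') where
  π : ∀ n : ℕ, Multi n V V'
  π_zero : π 0 = 0
  degree : ∀ n : ℕ, HasDegree 𝒱 𝒱' (1 - n) (π n)
  antisymm : ∀ n : ℕ, GradedAntisymmetric 𝒱 (π n)
  compat : ∀ (n : ℕ) (d : Fin n → ℤ) (x : Fin n → V), Homog 𝒱 d x →
    ∑ i : Fin (n + 1), ∑ σ : Perm (Fin n),
      (sgn ((n : ℤ) - i) * koszulAnti d σ / (((i : ℕ)! : ℝ) * ((n - (i : ℕ))! : ℝ))) •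
        π (n - i + 1)
          (Fin.cons (L.μ i (firstPart (x ∘ σ) i)) (lastPart (x ∘ σ) i) : Fin (n - i + 1) → V) =
    ∑ c : Composition n, ∑ σ : Perm (Fin n),
      (sgn (blockExponent c (d ∘ σ)) * koszulAnti d σ /
          ((c.length ! : ℝ) * ∏ m, ((c.blocksFun m)! : ℝ))) •
        L'.μ c.length (fun m => π (c.blocksFun m) (x ∘ σ ∘ c.embedding m))

/-- The sign in the cyclicity condition: a function `F` of `n = m + 1` homogeneous arguments is
cyclic if `F(x_1, …, x_n) = ± F(x_n, x_1, …, x_{n-1})` with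
`± = (-1)^{n-1 + (n-1)(|x_1|+|x_n|) + |x_n| ∑_{i<n} |x_i|}`. The argument `d` of `F` lists the degrees
of the arguments `x`. -/
def IsCyclic (𝒱 : ℤ → Submodule ℝ V) {m : ℕ}
    (F : (Fin (m + 1) → ℤ) → (Fin (m + 1) → V) → ℝ) : Prop :=
  ∀ d x, Homog 𝒱 d x →
    F d x =
      sgn (m + m * (d 0 + d (Fin.last m)) + d (Fin.last m) * ∑ i : Fin m, d i.castSucc) *
        F (Fin.cons (d (Fin.last m)) (fun i : Fin m => d i.castSucc))
          (Fin.cons (x (Fin.last m)) (fun i : Fin m => x i.castSucc))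

/-- The bulk bracket `[x_1, …, x_n]_V`, `n = m + 1`:
`⟨x_1, μ_{n-1}(x_2, …, x_n)⟩_V + ∑_{i+j=n} ± ⟨π_i(x_1, …, x_i), π_j(x_{i+1}, …, x_n)⟩_∂`, with the
Koszul sign `± = (-1)^{(n-1)(|x_1|-1) + (j-1) ∑_{r ≤ i} (|x_r|-1)}`, which is `+` if all arguments
have degree `1`. The terms with `i = 0` or `j = 0` vanish as `π_0 = 0`. -/
noncomputable def bulkBracket {𝒱 : ℤ → Submodule ℝ V} {𝒱' : ℤ → Submodule ℝ V'}
    {L : LInfinityAlgebra 𝒱} {L' : LInfinityAlgebra 𝒱'} (π : LInfinityMorphism L L')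
    (b : V →ₗ[ℝ] V →ₗ[ℝ] ℝ) (b' : V' →ₗ[ℝ] V' →ₗ[ℝ] ℝ) {m : ℕ}
    (d : Fin (m + 1) → ℤ) (x : Fin (m + 1) → V) : ℝ :=
  b (x 0) (L.μ m (fun k => x k.succ)) +
    ∑ i : Fin (m + 1 + 1),
      sgn (m * (d 0 - 1) + ((m : ℤ) + 1 - i - 1) * ∑ r, (firstPart d i r - 1)) *
        b' (π.π i (firstPart x i)) (π.π (m + 1 - i) (lastPart x i))

/-- The boundary bracket `[[x_1, …, x_n]]`, `n = m + 1`: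
`⟨x_1, μ_{n-1}(x_2, …, x_n)⟩ + (-1)^{|x_1||μ_{n-1}(x_2, …, x_n)|} ⟨μ_{n-1}(x_2, …, x_n), x_1⟩`. -/
noncomputable def boundaryBracket {𝒱' : ℤ → Submodule ℝ V'} (L' : LInfinityAlgebra 𝒱')
    (b' : V' →ₗ[ℝ] V' →ₗ[ℝ] ℝ) {m : ℕ} (d : Fin (m + 1) → ℤ) (x : Fin (m + 1) → V') : ℝ :=
  b' (x 0) (L'.μ m (fun k => x k.succ)) +
    sgn (d 0 * (∑ k : Fin m, d k.succ + (2 - m))) * b' (L'.μ m (fun k => x k.succ)) (x 0)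

/-- A cyclic structure on a relative `L_∞`-algebra `π : L → L'`. -/
structure CyclicStructure {𝒱 : ℤ → Submodule ℝ V} {𝒱' : ℤ → Submodule ℝ V'}
    {L : LInfinityAlgebra 𝒱} {L' : LInfinityAlgebra 𝒱'} (π : LInfinityMorphism L L') where
  /-- the bulk form `⟨-,-⟩_V` -/
  form : V →ₗ[ℝ] V →ₗ[ℝ] ℝ
  form_degree : FormHasDegree 𝒱 (-3) form
  form_symm : ∀ d e x y, x ∈ 𝒱 d → y ∈ 𝒱 e → form x y = sgn (d * e) * form y x
  form_nondegenerate : form.Nondegenerate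
  /-- the boundary form `⟨-,-⟩_∂`, with no symmetry and possibly degenerate -/
  bdryForm : V' →ₗ[ℝ] V' →ₗ[ℝ] ℝ
  bdryForm_degree : FormHasDegree 𝒱' (-2) bdryForm
  cyclic : ∀ m : ℕ, IsCyclic 𝒱 (m := m) (bulkBracket π form bdryForm)
  bdry_cyclic : ∀ m : ℕ, IsCyclic 𝒱' (m := m) (boundaryBracket L' bdryForm)

end LInfty

/-! ### Formal graded manifolds

The (formal, pointed) graded manifold modelled on a graded vector space `W`. Tensor fields on it are
given by their Taylor coefficients at the origin: a map or vector field `x ↦ ∑ₙ fₙ(x, …, x) / n!` by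
graded symmetric maps `fₙ : W^n → U`, a two-form `ω` by maps `ωₙ(v, w; x₁, …, xₙ)`, where `v, w` are the
tangent vectors on which the form is evaluated. -/

section Formal

variable {W U : Type*} [AddCommGroup W] [Module ℝ W] [AddCommGroup U] [Module ℝ U]

/-- A formal vector field of degree `q`. -/
structure FormalVectorField (𝒲 : ℤ → Submodule ℝ W) (q : ℤ) where
  coeff : ∀ n : ℕ, Multi n W W
  degree : ∀ n : ℕ, HasDegree 𝒲 𝒲 q (coeff n)
  symm : ∀ n : ℕ, GradedSymmetric 𝒲 (coeff n)

/-- A formal morphism of graded manifolds preserving the origin. -/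
structure FormalMap (𝒲 : ℤ → Submodule ℝ W) (𝒰 : ℤ → Submodule ℝ U) where
  coeff : ∀ n : ℕ, Multi n W U
  coeff_zero : coeff 0 = 0
  degree : ∀ n : ℕ, HasDegree 𝒲 𝒰 0 (coeff n)
  symm : ∀ n : ℕ, GradedSymmetric 𝒲 (coeff n)

variable {𝒲 : ℤ → Submodule ℝ W} {𝒰 : ℤ → Submodule ℝ U} {q k : ℤ}

/-- The Taylor coefficients, on homogeneous elements of degrees `d`, of the derivative of the formal
`U`-valued map with coefficients `f` along the vector field `Q`. -/
noncomputable def derivAlong (Q : FormalVectorField 𝒲 q) (f : ∀ n : ℕ, Multi n W U) {n : ℕ}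
    (d : Fin n → ℤ) (x : Fin n → W) : U :=
  ∑ i : Fin (n + 1), ∑ σ : Perm (Fin n),
    (koszul d σ / (((i : ℕ)! : ℝ) * ((n - (i : ℕ))! : ℝ))) •
      f (n - i + 1)
        (Fin.cons (Q.coeff i (firstPart (x ∘ σ) i)) (lastPart (x ∘ σ) i) : Fin (n - i + 1) → W)

/-- The Taylor coefficients of the composite `f ∘ Φ`. -/
noncomputable def compAlong {M : Type*} [AddCommGroup M] [Module ℝ M] (Φ : FormalMap 𝒲 𝒰)
    (f : ∀ n : ℕ, Multi n U M) {n : ℕ} (d : Fin n → ℤ) (x : Fin n → W) : M :=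
  ∑ c : Composition n, ∑ σ : Perm (Fin n),
    (koszul d σ / ((c.length ! : ℝ) * ∏ m, ((c.blocksFun m)! : ℝ))) •
      f c.length (fun m => Φ.coeff (c.blocksFun m) (x ∘ σ ∘ c.embedding m))

/-- `Q` is homological: it has degree `1` and `Q² = ½ [Q, Q] = 0`. -/
def FormalVectorField.IsHomological (Q : FormalVectorField 𝒲 1) : Prop :=
  ∀ (n : ℕ) (d : Fin n → ℤ) (x : Fin n → W), Homog 𝒲 d x → derivAlong Q Q.coeff d x = 0

/-- `Φ` relates the vector fields `Q` and `Q'`: `dΦ(Q) = Q' ∘ Φ`. -/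
def FormalMap.Relates (Φ : FormalMap 𝒲 𝒰) (Q : FormalVectorField 𝒲 q)
    (Q' : FormalVectorField 𝒰 q) : Prop :=
  ∀ (n : ℕ) (d : Fin n → ℤ) (x : Fin n → W), Homog 𝒲 d x →
    derivAlong Q Φ.coeff d x = compAlong Φ Q'.coeff d x

/-- A formal two-form of degree `k`. -/
structure TwoForm (𝒲 : ℤ → Submodule ℝ W) (k : ℤ) where
  coeff : ∀ n : ℕ, W →ₗ[ℝ] W →ₗ[ℝ] Multi n W ℝ
  degree : ∀ (n : ℕ) (a b : ℤ) (d : Fin n → ℤ) (v w : W) (x : Fin n → W),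
    v ∈ 𝒲 a → w ∈ 𝒲 b → Homog 𝒲 d x → a + b + ∑ j, d j + k ≠ 0 → coeff n v w x = 0
  antisymm : ∀ (n : ℕ) (a b : ℤ) (v w : W), v ∈ 𝒲 a → w ∈ 𝒲 b →
    coeff n v w = -(sgn (a * b) • coeff n w v)
  symm : ∀ (n : ℕ) (v w : W), GradedSymmetric 𝒲 (coeff n v w)

/-- The coefficients do not depend on the base point. -/
def TwoForm.IsConstant (ω : TwoForm 𝒲 k) : Prop := ∀ n : ℕ, 0 < n → ω.coeff n = 0

/-- `dω = 0`, where `dω(u, v, w)` is the alternating sum of the derivatives of `ω(v, w)`, `ω(u, w)`,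
`ω(u, v)` in the directions `u`, `v`, `w`. -/
def TwoForm.IsClosed (ω : TwoForm 𝒲 k) : Prop :=
  ∀ (n : ℕ) (a b c : ℤ) (d : Fin n → ℤ) (u v w : W) (x : Fin n → W),
    u ∈ 𝒲 a → v ∈ 𝒲 b → w ∈ 𝒲 c → Homog 𝒲 d x →
    sgn (a * (b + c)) * ω.coeff (n + 1) v w (Fin.cons u x : Fin (n + 1) → W)
      - sgn (b * c) * ω.coeff (n + 1) u w (Fin.cons v x : Fin (n + 1) → W)
      + ω.coeff (n + 1) u v (Fin.cons w x : Fin (n + 1) → W) = 0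

/-- The Taylor coefficients of the Lie derivative `𝓛_Q ω`, evaluated on homogeneous `v, w` of degrees
`a, b` and `x` of degrees `d`: up to Koszul signs,
`(𝓛_Q ω)_x(v, w) = ω_x(D_v Q(x), w) + ω_x(v, D_w Q(x)) + (D_{Q(x)} ω)_x(v, w)`. The prefactor
`(-1)^{q k}` comes from `Q` acting from the left. -/
noncomputable def lieDerivative (Q : FormalVectorField 𝒲 q) (ω : TwoForm 𝒲 k) {n : ℕ}
    (a b : ℤ) (d : Fin n → ℤ) (v w : W) (x : Fin n → W) : ℝ :=
  sgn (q * k) * ∑ i : Fin (n + 1), ∑ σ : Perm (Fin n),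
    koszul d σ / (((i : ℕ)! : ℝ) * ((n - (i : ℕ))! : ℝ)) *
      (sgn (b * ∑ r, firstPart (d ∘ σ) i r) *
          ω.coeff (n - i)
            (Q.coeff (i + 1) (Fin.cons v (firstPart (x ∘ σ) i) : Fin ((i : ℕ) + 1) → W)) w
            (lastPart (x ∘ σ) i)
        + sgn (q * a) *
          ω.coeff (n - i) v
            (Q.coeff (i + 1) (Fin.cons w (firstPart (x ∘ σ) i) : Fin ((i : ℕ) + 1) → W))
            (lastPart (x ∘ σ) i)
        + sgn (q * (a + b)) *
          ω.coeff (n - i + 1) v w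
            (Fin.cons (Q.coeff i (firstPart (x ∘ σ) i)) (lastPart (x ∘ σ) i) :
              Fin (n - i + 1) → W))

/-- The Taylor coefficients of the pullback `Φ^* ω`, evaluated on homogeneous `v, w` of degrees `a, b`
(the degree `a` enters no sign) and `x` of degrees `d`: up to Koszul signs,
`(Φ^* ω)_x(v, w) = ω_{Φ(x)}(D_v Φ(x), D_w Φ(x))`. -/
noncomputable def pullback (Φ : FormalMap 𝒲 𝒰) (ω : TwoForm 𝒰 k) {n : ℕ}
    (b : ℤ) (d : Fin n → ℤ) (v w : W) (x : Fin n → W) : ℝ :=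
  ∑ i : Fin (n + 1), ∑ j : Fin (n - i + 1), ∑ c : Composition (n - i - j), ∑ σ : Perm (Fin n),
    koszul d σ * sgn (b * ∑ r, firstPart (d ∘ σ) i r) /
        (((i : ℕ)! : ℝ) * ((j : ℕ)! : ℝ) * ((c.length ! : ℝ) * ∏ m, ((c.blocksFun m)! : ℝ))) *
      ω.coeff c.length
        (Φ.coeff (i + 1) (Fin.cons v (firstPart (x ∘ σ) i) : Fin ((i : ℕ) + 1) → W))
        (Φ.coeff (j + 1)
          (Fin.cons w (firstPart (lastPart (x ∘ σ) i) j) : Fin ((j : ℕ) + 1) → W))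
        (fun m => Φ.coeff (c.blocksFun m) (lastPart (lastPart (x ∘ σ) i) j ∘ c.embedding m))

/-- A BV–BFV pair `(W, Q, ω) → (U, Q', ω')` of formal graded manifolds, with two-forms of degrees
`k` and `k'`: homological vector fields, a map of dg-manifolds `Φ`, and closed two-forms with
`𝓛_Q ω + Φ^* ω' = 0` and `𝓛_{Q'} ω' = 0`. -/
structure BVBFVPair (𝒲 : ℤ → Submodule ℝ W) (𝒰 : ℤ → Submodule ℝ U) (k k' : ℤ) where
  Q : FormalVectorField 𝒲 1
  Q_homological : Q.IsHomological
  Q' : FormalVectorField 𝒰 1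
  Q'_homological : Q'.IsHomological
  Φ : FormalMap 𝒲 𝒰
  Φ_relates : Φ.Relates Q Q'
  ω : TwoForm 𝒲 k
  ω_closed : ω.IsClosed
  ω' : TwoForm 𝒰 k'
  ω'_closed : ω'.IsClosed
  lie_add_pullback : ∀ (n : ℕ) (a b : ℤ) (d : Fin n → ℤ) (v w : W) (x : Fin n → W),
    v ∈ 𝒲 a → w ∈ 𝒲 b → Homog 𝒲 d x →
      lieDerivative Q ω a b d v w x + pullback Φ ω' b d v w x = 0
  lie' : ∀ (n : ℕ) (a b : ℤ) (d : Fin n → ℤ) (v w : U) (x : Fin n → U),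
    v ∈ 𝒰 a → w ∈ 𝒰 b → Homog 𝒰 d x → lieDerivative Q' ω' a b d v w x = 0

end Formal

/-! ### Encoding -/

section Encoding

variable {V V' : Type*} [AddCommGroup V] [Module ℝ V] [AddCommGroup V'] [Module ℝ V']
  {𝒱 : ℤ → Submodule ℝ V} {𝒱' : ℤ → Submodule ℝ V'}

/-- The exponent of the décalage sign: `∑_k (n - k) (|x_k| - 1)` for `x_1, …, x_n` of degrees `d` in
the unshifted space. -/
def decalage {n : ℕ} (d : Fin n → ℤ) : ℤ := ∑ k : Fin n, ((n : ℤ) - 1 - k) * (d k - 1)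

/-- `Q` on `V[1]` encodes the brackets:
`Qₙ(x_1, …, x_n) = - (-1)^{∑_k (n-k)(|x_k|-1)} μ_n(x_1, …, x_n)`. -/
def EncodesBrackets (Q : FormalVectorField (shift 𝒱) 1) (L : LInfinityAlgebra 𝒱) : Prop :=
  ∀ (n : ℕ) (d : Fin n → ℤ) (x : Fin n → V), Homog 𝒱 d x →
    Q.coeff n x = -(sgn (decalage d) • L.μ n x)

/-- `Φ : V[1] → V'[1]` encodes the `L_∞`-morphism:
`Φₙ(x_1, …, x_n) = (-1)^{∑_k (n-k)(|x_k|-1)} π_n(x_1, …, x_n)`. -/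
def EncodesMorphism {L : LInfinityAlgebra 𝒱} {L' : LInfinityAlgebra 𝒱'}
    (Φ : FormalMap (shift 𝒱) (shift 𝒱')) (π : LInfinityMorphism L L') : Prop :=
  ∀ (n : ℕ) (d : Fin n → ℤ) (x : Fin n → V), Homog 𝒱 d x →
    Φ.coeff n x = sgn (decalage d) • π.π n x

/-- The value of `ω` at the origin is `ω(v, w) = (-1)^{|v|} ⟨v, w⟩`, with `|v|` the degree in `V`. -/
def EncodesForm {k : ℤ} (ω : TwoForm (shift 𝒱) k) (b : V →ₗ[ℝ] V →ₗ[ℝ] ℝ) : Prop :=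
  ∀ (d : ℤ) (v w : V) (x : Fin 0 → V), v ∈ 𝒱 d → ω.coeff 0 v w x = sgn d * b v w

/-- The value of `ω` at the origin is
`ω(v, w) = (-1)^{|v|} (⟨v, w⟩ + (-1)^{|v||w|} ⟨w, v⟩)`. -/
def EncodesSymmetrizedForm {k : ℤ} (ω : TwoForm (shift 𝒱) k) (b : V →ₗ[ℝ] V →ₗ[ℝ] ℝ) : Prop :=
  ∀ (d e : ℤ) (v w : V) (x : Fin 0 → V), v ∈ 𝒱 d → w ∈ 𝒱 e →
    ω.coeff 0 v w x = sgn d * (b v w + sgn (d * e) * b w v)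

end Encoding

end RelLInfty

/-!
The proof translates everything into the shifted degrees `e = d - 1`, where signs become plain
Koszul signs, and then shows that cyclicity is a much stronger condition than it looks.

**Signs.** The Koszul sign is a cocycle (`koszul_mul`), and the décalage sign turns the antisymmetric
Koszul sign in the degrees `d` into the Koszul sign in the degrees `e` (`koszul_mul_sgn_decalage`).
Hence the décalage of a graded antisymmetric map is graded symmetric, and up to a common sign the
homotopy Jacobi identities and the morphism identities are term by term the equations `Q² = 0` and
`dΠ(Q) = Q_∂ ∘ Π` (`field_isHomological`, `map_relates`).

**Forms.** The two-forms are constant, hence closed. In the Lie derivative only the terms with all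
base point arguments in `Q` survive, and it becomes the difference of the contractions
`A(v, w, x) = ± ω(v, Q(w, x))` and `± A(w, v, x)`. In the pullback only the terms `ω'(Π(v, I), Π(w, J))`
survive, where `I`, `J` are complementary blocks of the arguments `x`. Writing `ω'` as the
symmetrization of `⟨-,-⟩_∂`, each of them is a difference of two pairings
`β_p(y) = ± ⟨Π_p(y_1, …, y_p), Π_{n-p}(y_{p+1}, …, y_n)⟩`, namely of `β_{|I|+1}(v, I, w, J)` and
`β_{|J|+1}(w, J, v, I)`. In the same terms the bulk bracket is `A + ∑_p β_p` (`sgn_bulkBracket`).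

**Cyclicity.** Put `G_1 = A + β_1` and `G_p = β_p` for the other `p`. Then `G_p` is symmetric in its
first `p` and in its last `n - p` arguments, and `∑_p G_p` is invariant under rotation. This forces
every single `G_p` to be symmetric in all arguments (`const_of_rotation_invariant`): the exchange of
two adjacent arguments `a`, `b` changes the sum by an amount `g(a) - g(b)` that does not depend on
their position, but when they are the first and the last argument, it changes each of the `n - 1`
nonconstant summands by `g(b) - g(a)`, so that `n (g(a) - g(b)) = 0`. Thus in the pullback all `G_p`
cancel under the exchange of `I` and `J`, and only the corrections by `A` remain, from the two terms
in which `I` or `J` is empty. They are minus the Lie derivative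
(`lieDerivative_add_pullback_eq_zero`). The boundary equation `𝓛_{Q_∂} ω_∂ = 0` is the case without
pairings (`TwoForm.HasValue.lieDerivative_eq_zero`).
-/

namespace RelLInfty

open scoped Nat
open Equiv (Perm)

/-! ### Signs -/

lemma sgn_add (a b : ℤ) : sgn (a + b) = sgn a * sgn b := zpow_add₀ (by norm_num) _ _

lemma sgn_zero : sgn 0 = 1 := zpow_zero _

lemma sgn_one : sgn 1 = -1 := zpow_one _

lemma sgn_two_mul (c : ℤ) : sgn (2 * c) = 1 := (even_two_mul c).neg_one_zpow

lemma sgn_congr {a b : ℤ} (c : ℤ) (h : a = b + 2 * c) : sgn a = sgn b := by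
  rw [h, sgn_add, sgn_two_mul, mul_one]

lemma sgn_neg (a : ℤ) : sgn (-a) = sgn a := sgn_congr (-a) (by ring)

lemma sgn_mul_self (a : ℤ) : sgn a * sgn a = 1 := by
  rw [← sgn_add, ← two_mul, sgn_two_mul]

lemma sgn_sum {ι : Type*} (s : Finset ι) (f : ι → ℤ) : sgn (∑ i ∈ s, f i) = ∏ i ∈ s, sgn (f i) := by
  classical
  induction s using Finset.induction_on with
  | empty => simp [sgn_zero]
  | insert a s ha ih => rw [Finset.sum_insert ha, Finset.prod_insert ha, sgn_add, ih]

lemma sgn_natCast_mul (k : ℕ) (a : ℤ) : sgn (k * a) = sgn a ^ k := by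
  rw [sgn, mul_comm, zpow_mul, zpow_natCast, sgn]

/-- Splitting a product over `n` indices into the first `i` and the last `n - i`. -/
lemma prod_split {M : Type*} [CommMonoid M] {n : ℕ} (i : Fin (n + 1)) (f : Fin n → M) :
    ∏ k, f k = (∏ k, firstPart f i k) * ∏ k, lastPart f i k := by
  obtain ⟨i, hi⟩ := i
  obtain ⟨j, rfl⟩ := Nat.exists_eq_add_of_le (Nat.lt_succ_iff.1 hi)
  rw [Fin.prod_univ_add]
  congr 1
  exact Fintype.prod_equiv (finCongr (by simp)) _ _ fun k => rfl

lemma prod_eq_prod_firstPart {M : Type*} [CommMonoid M] {n : ℕ} (i : Fin (n + 1)) (f : Fin n → M)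
    (h : ∀ k, lastPart f i k = 1) : ∏ k, f k = ∏ k, firstPart f i k := by
  rw [prod_split i, Finset.prod_eq_one fun k _ => h k, mul_one]

lemma prod_eq_prod_lastPart {M : Type*} [CommMonoid M] {n : ℕ} (i : Fin (n + 1)) (f : Fin n → M)
    (h : ∀ k, firstPart f i k = 1) : ∏ k, f k = ∏ k, lastPart f i k := by
  rw [prod_split i, Finset.prod_eq_one fun k _ => h k, one_mul]

lemma sum_split {M : Type*} [AddCommMonoid M] {n : ℕ} (i : Fin (n + 1)) (f : Fin n → M) :
    ∑ k, f k = (∑ k, firstPart f i k) + ∑ k, lastPart f i k :=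
  prod_split (M := Multiplicative M) i f

/-! ### Koszul signs -/

lemma koszul_eq_prod_Ioi {n : ℕ} (d : Fin n → ℤ) (σ : Perm (Fin n)) :
    koszul d σ =
      ∏ i, ∏ j ∈ Finset.Ioi i, if σ j < σ i then sgn (d (σ i) * d (σ j)) else 1 := by
  refine Finset.prod_congr rfl fun i _ => ?_
  rw [← Finset.prod_subset (Finset.subset_univ (Finset.Ioi i))]
  · exact Finset.prod_congr rfl fun j hj => by simp [Finset.mem_Ioi.1 hj]
  · intro j _ hj
    rw [if_neg]
    simp_all

/-- Products of a symmetric expression over all pairs are invariant under permutations. -/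
lemma prod_Ioi_comp_perm {n : ℕ} (σ : Perm (Fin n)) (c : Fin n → Fin n → ℝ)
    (hc : ∀ i j, c i j = c j i) :
    ∏ i, ∏ j ∈ Finset.Ioi i, c (σ i) (σ j) = ∏ i, ∏ j ∈ Finset.Ioi i, c i j := by
  -- compare the antisymmetric expressions `i - j` and `c i j * (i - j)`
  have h₁ := σ.prod_Ioi_comp_eq_sign_mul_prod (R := ℝ) (f := fun i j => (i : ℝ) - (j : ℝ))
    (fun i j => by ring)
  have h₂ := σ.prod_Ioi_comp_eq_sign_mul_prod (R := ℝ)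
    (f := fun i j => c i j * ((i : ℝ) - (j : ℝ))) (fun i j => by rw [hc]; ring)
  simp only [Finset.prod_mul_distrib] at h₂
  rw [h₁] at h₂
  have h0 : ((Perm.sign σ : ℤ) : ℝ) * ∏ i : Fin n, ∏ j ∈ Finset.Ioi i, ((i : ℝ) - (j : ℝ)) ≠ 0 := by
    refine mul_ne_zero (by exact_mod_cast Units.ne_zero _) ?_
    refine Finset.prod_ne_zero_iff.2 fun i _ => Finset.prod_ne_zero_iff.2 fun j hj => ?_
    rw [sub_ne_zero]
    exact_mod_cast Fin.val_ne_of_ne (Finset.mem_Ioi.1 hj).ne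
  refine mul_right_cancel₀ h0 (h₂.trans ?_)
  ring

/-- The Koszul sign is a cocycle. -/
lemma koszul_mul {n : ℕ} (d : Fin n → ℤ) (σ τ : Perm (Fin n)) :
    koszul d (σ * τ) = koszul d σ * koszul (d ∘ σ) τ := by
  rw [koszul_eq_prod_Ioi, koszul_eq_prod_Ioi, koszul_eq_prod_Ioi]
  have h := prod_Ioi_comp_perm τ
    (fun i j => if (i < j ∧ σ j < σ i) ∨ (j < i ∧ σ i < σ j) then sgn (d (σ i) * d (σ j)) else 1)
    (fun i j => by rw [mul_comm (d (σ i))]; congr 1; exact propext or_comm)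
  have h' : ∏ i, ∏ j ∈ Finset.Ioi i, (if σ j < σ i then sgn (d (σ i) * d (σ j)) else 1) =
      ∏ i, ∏ j ∈ Finset.Ioi i, (if (i < j ∧ σ j < σ i) ∨ (j < i ∧ σ i < σ j) then
        sgn (d (σ i) * d (σ j)) else 1) := by
    refine Finset.prod_congr rfl fun i _ => Finset.prod_congr rfl fun j hj => ?_
    have hij := Finset.mem_Ioi.1 hj
    simp [hij, hij.not_gt]
  rw [h', ← h]
  simp only [← Finset.prod_mul_distrib]
  refine Finset.prod_congr rfl fun i _ => Finset.prod_congr rfl fun j hj => ?_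
  have hij := (Finset.mem_Ioi.1 hj).ne
  have h1 : τ i ≠ τ j := fun h => hij (τ.injective h)
  have h2 : σ (τ i) ≠ σ (τ j) := fun h => h1 (σ.injective h)
  simp only [Perm.mul_apply, Function.comp]
  rcases lt_or_gt_of_ne h1 with h1 | h1 <;> rcases lt_or_gt_of_ne h2 with h2 | h2 <;>
    simp [h1, h2, h1.not_gt, h2.not_gt, sgn_mul_self]

lemma koszul_one {n : ℕ} (d : Fin n → ℤ) : koszul d 1 = 1 := by
  rw [koszul_eq_prod_Ioi]
  refine Finset.prod_eq_one fun i _ => Finset.prod_eq_one fun j hj => ?_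
  exact if_neg (Finset.mem_Ioi.1 hj).not_gt

lemma sgn_decalage_eq_prod {n : ℕ} (e : Fin n → ℤ) :
    sgn (decalage fun k => e k + 1) = ∏ i, ∏ _j ∈ Finset.Ioi i, sgn (e i) := by
  rw [decalage, sgn_sum]
  refine Finset.prod_congr rfl fun i _ => ?_
  rw [Finset.prod_const, Fin.card_Ioi, ← sgn_natCast_mul]
  congr 1
  have := i.2
  rw [add_sub_cancel_right]
  congr 1
  omega

/-- The décalage sign exchanges the antisymmetric Koszul sign and the Koszul sign for the shifted
degrees. -/
lemma koszul_mul_sgn_decalage {n : ℕ} (e : Fin n → ℤ) (σ : Perm (Fin n)) :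
    koszul e σ * sgn (decalage fun k => e (σ k) + 1) =
      sgn (decalage fun k => e k + 1) * koszulAnti (fun k => e k + 1) σ := by
  -- an antisymmetric expression whose product over all `i < j` is the décalage sign
  have h := σ.prod_Ioi_comp_eq_sign_mul_prod (R := ℝ)
    (f := fun i j => if i < j then sgn (e i) else if j < i then - sgn (e j) else 0)
    (fun i j => by
      rcases lt_trichotomy i j with h | h | h <;> simp [h, h.not_gt])
  have h' : ∏ i, ∏ j ∈ Finset.Ioi i, (if i < j then sgn (e i) else
      if j < i then - sgn (e j) else 0) = sgn (decalage fun k => e k + 1) := by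
    rw [sgn_decalage_eq_prod]
    refine Finset.prod_congr rfl fun i _ => Finset.prod_congr rfl fun j hj => ?_
    simp [Finset.mem_Ioi.1 hj]
  rw [h'] at h
  have key : koszul e σ * sgn (decalage fun k => e (σ k) + 1) =
      (∏ i, ∏ j ∈ Finset.Ioi i, (if σ i < σ j then sgn (e (σ i)) else
        if σ j < σ i then - sgn (e (σ j)) else 0)) * koszul (fun k => e k + 1) σ := by
    rw [sgn_decalage_eq_prod (fun k => e (σ k)), koszul_eq_prod_Ioi, koszul_eq_prod_Ioi]
    simp only [← Finset.prod_mul_distrib]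
    refine Finset.prod_congr rfl fun i _ => Finset.prod_congr rfl fun j hj => ?_
    have h2 : σ i ≠ σ j := fun h => (Finset.mem_Ioi.1 hj).ne (σ.injective h)
    rcases lt_or_gt_of_ne h2 with h2 | h2
    · simp [h2, h2.not_gt]
    · simp only [h2, h2.not_gt, if_true, if_false]
      rw [← sgn_add, neg_mul, ← sgn_add, ← neg_one_mul, ← sgn_one, ← sgn_add]
      exact sgn_congr (-e (σ j) - 1) (by ring)
  rw [key, h, koszulAnti]
  ring

/-- A permutation that preserves the first `p` positions restricts to permutations of the first `p`
and of the last `n - p` positions, and its Koszul sign is the product of theirs. -/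
lemma exists_perm_parts {n : ℕ} (p : Fin (n + 1)) (τ : Perm (Fin n))
    (hτ : ∀ k, (τ k : ℕ) < p ↔ (k : ℕ) < p) :
    ∃ (τ₁ : Perm (Fin (p : ℕ))) (τ₂ : Perm (Fin (n - (p : ℕ)))),
      firstPart τ p = firstPart id p ∘ τ₁ ∧ lastPart τ p = lastPart id p ∘ τ₂ ∧
      ∀ d : Fin n → ℤ,
        koszul d τ = koszul (firstPart d p) τ₁ * koszul (lastPart d p) τ₂ := by
  have hp := p.2
  let f₁ : Fin (p : ℕ) → Fin (p : ℕ) := fun k => ⟨τ ⟨k, by omega⟩, (hτ _).2 k.2⟩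
  have hlast : ∀ k : Fin (n - (p : ℕ)), (p : ℕ) ≤ τ ⟨p + k, by omega⟩ := fun k => by
    have := hτ ⟨p + k, by omega⟩
    simp only [Nat.not_lt.symm]
    simp [this]
  let f₂ : Fin (n - (p : ℕ)) → Fin (n - (p : ℕ)) := fun k =>
    ⟨τ ⟨p + k, by omega⟩ - p, by have := hlast k; omega⟩
  have hf₂ : ∀ k, (p : ℕ) + f₂ k = τ ⟨p + k, by omega⟩ := fun k => by
    have := hlast k
    simp only [f₂]
    omega
  have h₁ : Function.Injective f₁ := fun a b h => by
    have := τ.injective (Fin.ext (Fin.ext_iff.1 h : _))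
    simpa [Fin.ext_iff] using this
  have h₂ : Function.Injective f₂ := fun a b h => by
    have h' : (τ ⟨p + a, by omega⟩ : ℕ) = τ ⟨p + b, by omega⟩ := by rw [← hf₂, ← hf₂, h]
    have := Fin.ext_iff.1 (τ.injective (Fin.ext h'))
    exact Fin.ext (by simpa using this)
  refine ⟨Equiv.ofBijective f₁ (Finite.injective_iff_bijective.1 h₁),
    Equiv.ofBijective f₂ (Finite.injective_iff_bijective.1 h₂), rfl, ?_, fun d => ?_⟩
  · funext k
    exact Fin.ext (hf₂ k).symm
  · have hd : ∀ k : Fin (n - (p : ℕ)), d (τ ⟨p + k, by omega⟩) = lastPart d p (f₂ k) := fun k =>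
      congrArg d (Fin.ext (hf₂ k).symm)
    rw [koszul, prod_split p]
    congr 1
    · refine Finset.prod_congr rfl fun i _ => ?_
      simp only [firstPart]
      rw [prod_eq_prod_firstPart p]
      · rfl
      · intro j
        simp only [lastPart]
        rw [if_neg]
        rintro ⟨-, h⟩
        have h3 := (f₁ i).2
        have h4 := hlast j
        have h5 : (τ ⟨p + j, by omega⟩ : ℕ) < (f₁ i : ℕ) := h
        omega
    · refine Finset.prod_congr rfl fun i _ => ?_
      simp only [lastPart]
      rw [prod_eq_prod_lastPart p]
      · refine Finset.prod_congr rfl fun j _ => ?_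
        rw [lastPart, hd, hd]
        congr 1
        simp only [Fin.lt_def, ← hf₂, Equiv.ofBijective_apply, eq_iff_iff]
        omega
      · intro j
        simp only [firstPart]
        rw [if_neg]
        rintro ⟨h, -⟩
        have h5 : ((p : ℕ) + i) < (j : ℕ) := h
        omega

lemma cycleRange_castSucc_of_lt {n : ℕ} (p : Fin (n + 1)) (k : Fin n) (hk : (k : ℕ) < p) :
    p.cycleRange k.castSucc = k.succ := by
  rw [Fin.cycleRange_of_lt (by simpa [Fin.lt_def] using hk)]
  ext
  rw [Fin.val_add_one_of_lt (Fin.castSucc_lt_last k)]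
  simp

lemma cycleRange_succ_of_le {n : ℕ} (p : Fin (n + 1)) (k : Fin n) (hk : (p : ℕ) ≤ k) :
    p.cycleRange k.succ = k.succ :=
  Fin.cycleRange_of_gt (by rw [Fin.lt_def, Fin.val_succ]; omega)

/-- The Koszul sign of moving the first entry to position `p`. -/
lemma koszul_cycleRange {n : ℕ} (a : ℤ) (e : Fin n → ℤ) (p : Fin (n + 1)) :
    koszul (Fin.cons a e : Fin (n + 1) → ℤ) p.cycleRange = sgn (a * ∑ k, firstPart e p k) := by
  have h : ∀ i j : Fin (n + 1), (i < j ∧ p.cycleRange j < p.cycleRange i) ↔ j = p ∧ i < p := by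
    have hval : ∀ k : Fin (n + 1), (p.cycleRange k : ℕ) =
        if (k : ℕ) < p then (k : ℕ) + 1 else if (k : ℕ) = p then 0 else k := by
      intro k
      rcases lt_trichotomy k p with hk | rfl | hk
      · rw [Fin.coe_cycleRange_of_lt hk, if_pos (Fin.lt_def.1 hk)]
      · simp
      · rw [Fin.cycleRange_of_gt hk, if_neg (Fin.lt_def.1 hk).not_gt, if_neg (Fin.val_ne_of_ne hk.ne')]
    intro i j
    rw [Fin.lt_def, Fin.lt_def, Fin.lt_def, Fin.ext_iff, hval, hval]
    split_ifs <;> omega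
  rw [koszul, Finset.mul_sum, sgn_sum, prod_split (Fin.castSucc p)]
  have h₂ : ∀ k, lastPart (fun i => ∏ j, if i < j ∧ p.cycleRange j < p.cycleRange i then
      sgn ((Fin.cons a e : Fin (n + 1) → ℤ) (p.cycleRange i) *
        (Fin.cons a e : Fin (n + 1) → ℤ) (p.cycleRange j)) else 1) (Fin.castSucc p) k = 1 := by
    intro k
    refine Finset.prod_eq_one fun j _ => ?_
    rw [if_neg]
    rw [h, Fin.lt_def]
    simp
  rw [Finset.prod_congr rfl fun k _ => h₂ k, Finset.prod_const_one, mul_one]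
  refine Finset.prod_congr rfl fun k _ => ?_
  have hk := k.2
  have hp := p.2
  simp only [Fin.val_castSucc] at hk
  simp only [firstPart]
  have h3 : p.cycleRange ⟨k, by omega⟩ = Fin.succ ⟨k, by omega⟩ :=
    cycleRange_castSucc_of_lt p ⟨k, by omega⟩ hk
  rw [Finset.prod_eq_single p]
  · rw [if_pos ((h _ _).2 ⟨rfl, by simp [Fin.lt_def]⟩), Fin.cycleRange_self, h3,
      Fin.cons_succ, Fin.cons_zero, mul_comm]
  · intro j _ hj
    rw [if_neg]
    rw [h]
    tauto
  · simp

/-- The permutation exchanging a block of length `p` with a block of length `n - p`. -/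
lemma exists_perm_flip {n : ℕ} (p : Fin (n + 1)) :
    ∃ τ : Perm (Fin n),
      firstPart τ ⟨n - p, by omega⟩ = lastPart id p ∧
      lastPart τ ⟨n - p, by omega⟩ =
        firstPart id p ∘ Fin.cast (show n - (n - (p : ℕ)) = p by omega) ∧
      ∀ d : Fin n → ℤ,
        koszul d τ = sgn ((∑ k, firstPart d p k) * ∑ k, lastPart d p k) := by
  have hp := p.2
  let f : Fin n → Fin n := fun k =>
    if h : (k : ℕ) < n - p then ⟨p + k, by omega⟩ else ⟨k - (n - p), by omega⟩
  have hf : Function.Injective f := fun a b h => by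
    simp only [f] at h
    split_ifs at h <;> simp only [Fin.mk.injEq] at h <;> ext <;> omega
  let τ := Equiv.ofBijective f (Finite.injective_iff_bijective.1 hf)
  have hτ₁ : firstPart τ ⟨n - p, by omega⟩ = lastPart id p := by
    funext k
    have hk := k.2
    simp only [] at hk
    simp [firstPart, lastPart, τ, f]
  have hτ₂ : lastPart τ ⟨n - p, by omega⟩ =
      firstPart id p ∘ Fin.cast (show n - (n - (p : ℕ)) = p by omega) := by
    funext k
    simp [firstPart, lastPart, τ, f]
  refine ⟨τ, hτ₁, hτ₂, fun d => ?_⟩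
  have h₁ : ∀ k : Fin (n - (p : ℕ)), τ ⟨k, by omega⟩ = ⟨p + k, by omega⟩ := congrFun hτ₁
  have h₂ : ∀ k : Fin (n - (n - (p : ℕ))), τ ⟨n - p + k, by omega⟩ = ⟨k, by omega⟩ :=
    congrFun hτ₂
  rw [koszul, prod_eq_prod_firstPart ⟨n - p, by omega⟩, mul_comm, Finset.sum_mul_sum, sgn_sum]
  · refine Finset.prod_congr rfl fun i _ => ?_
    have hi := i.2
    simp only [] at hi
    simp only [firstPart]
    rw [sgn_sum, prod_eq_prod_lastPart ⟨n - p, by omega⟩]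
    · refine Fintype.prod_equiv (finCongr (by simp; omega)) _ _ fun j => ?_
      simp only [lastPart]
      rw [h₁, h₂, if_pos]
      · rfl
      · have := j.2
        simp only [Fin.lt_def] at this ⊢
        omega
    · intro j
      simp only [firstPart]
      rw [h₁, h₁, if_neg]
      simp only [Fin.lt_def]
      omega
  · intro i
    refine Finset.prod_eq_one fun j _ => ?_
    rw [if_neg]
    rintro ⟨h, h'⟩
    have h3 := h₂ ⟨j - (n - p), by simp only [Fin.lt_def] at h; have := j.2; omega⟩
    have h4 : (⟨n - p + (j - (n - p)), by simp only [Fin.lt_def] at h; omega⟩ : Fin n) = j := by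
      ext
      simp only [Fin.lt_def] at h ⊢
      omega
    simp only [h4] at h3
    rw [h3, h₂ i] at h'
    simp only [Fin.lt_def] at h h'
    omega

lemma koszul_swap_zero_one {n : ℕ} (e : Fin (n + 2) → ℤ) :
    koszul e (Equiv.swap 0 1) = sgn (e 0 * e 1) := by
  have h : Equiv.swap (0 : Fin (n + 2)) 1 = Fin.cycleRange 1 := by
    refine Equiv.ext <| Fin.cases ?_ <| Fin.cases ?_ fun k => ?_
    · rw [Equiv.swap_apply_left]
      exact (cycleRange_castSucc_of_lt (n := n + 1) 1 0 (by simp)).symm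
    · change Equiv.swap (0 : Fin (n + 2)) 1 1 = Fin.cycleRange 1 1
      rw [Equiv.swap_apply_right, Fin.cycleRange_self]
    · rw [cycleRange_succ_of_le 1 k.succ (by simp), Equiv.swap_apply_of_ne_of_ne] <;>
        simp [Fin.ext_iff]
  have h' := koszul_cycleRange (e 0) (fun k => e k.succ) 1
  rw [h, ← Fin.cons_self_tail e]
  refine h'.trans ?_
  congr 2
  exact Fin.sum_univ_one _

lemma exists_perm_cons {n : ℕ} (σ : Perm (Fin n)) :
    ∃ τ : Perm (Fin (n + 1)), τ 0 = 0 ∧ ∀ k : Fin n, τ k.succ = (σ k).succ :=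
  ⟨Equiv.Perm.decomposeFin.symm (0, σ), by simp, by simp⟩

lemma exists_perm_tail {n : ℕ} {τ : Perm (Fin (n + 1))} (h0 : τ 0 = 0) :
    ∃ σ : Perm (Fin n), ∀ k : Fin n, τ k.succ = (σ k).succ := by
  obtain ⟨⟨p, σ⟩, rfl⟩ := Equiv.Perm.decomposeFin.symm.surjective τ
  obtain rfl : p = 0 := by simpa using h0
  exact ⟨σ, by simp⟩

/-- Fixing the first entry does not change the Koszul sign. -/
lemma koszul_of_fix_zero {n : ℕ} {τ : Perm (Fin (n + 1))} {σ : Perm (Fin n)} (h0 : τ 0 = 0)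
    (hs : ∀ k : Fin n, τ k.succ = (σ k).succ) (e : Fin (n + 1) → ℤ) :
    koszul e τ = koszul (fun k => e k.succ) σ := by
  rw [koszul, Fin.prod_univ_succ, koszul]
  simp only [Fin.prod_univ_succ, h0, hs]
  simp

/-! ### Rotation-invariant sums of functions of initial segments -/

open Equiv in
/-- Let `G p` be functions of permutations `σ` that depend only on the set of the first `p` values
of `σ`. If `∑ p, G p` is invariant under rotation, then every `G p` is constant.

The difference `D_j` of `G (j + 1)` under exchange of the entries `j`, `j + 1` is also that of the
sum. Rotating, it is a function `g a - g b` of the two exchanged entries `a`, `b`; exchanging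
the first and the last entry in a rotated tuple changes all summands by `g b - g a`, so that
`g a - g b = (m + 1) (g b - g a)`. -/
theorem const_of_rotation_invariant {m : ℕ} (G : Fin (m + 3) → Perm (Fin (m + 2)) → ℝ)
    (hG : ∀ (p : Fin (m + 3)) (σ τ : Perm (Fin (m + 2))),
      (∀ k : Fin (m + 2), (τ k : ℕ) < p ↔ (k : ℕ) < p) → G p (σ * τ) = G p σ)
    (hrot : ∀ σ, ∑ p, G p (σ * finRotate (m + 2)) = ∑ p, G p σ) (p : Fin (m + 3))
    (σ : Perm (Fin (m + 2))) : G p σ = G p 1 := by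
  set ρ := finRotate (m + 2) with hρ
  have hρs : ∀ j : Fin (m + 1), ρ j.castSucc = j.succ := fun j => by
    rw [hρ, finRotate_apply, Fin.coeSucc_eq_succ]
  have hρl : ρ (Fin.last _) = 0 := by rw [hρ, finRotate_last]
  have hsplit : ∀ f : Fin (m + 3) → ℝ,
      ∑ p, f p = f 0 + ∑ j : Fin (m + 1), f j.castSucc.succ + f (Fin.last _) := fun f => by
    rw [Fin.sum_univ_castSucc, Fin.sum_univ_succ]
    rfl
  let s : Fin (m + 1) → Perm (Fin (m + 2)) := fun j => swap j.castSucc j.succ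
  let D : Fin (m + 1) → Perm (Fin (m + 2)) → ℝ := fun j σ =>
    G j.castSucc.succ σ - G j.castSucc.succ (σ * s j)
  have hs : ∀ (j : Fin (m + 1)) (p : Fin (m + 3)), p ≠ j.castSucc.succ → ∀ σ,
      G p (σ * s j) = G p σ := fun j p hp σ => hG _ _ _ fun k => by
    have hp' : (p : ℕ) ≠ j + 1 := fun h => hp (Fin.ext (by simpa using h))
    simp only [s, swap_apply_def]
    split_ifs with h1 h2
    · rw [h1, Fin.val_succ, Fin.val_castSucc]; omega
    · rw [h2, Fin.val_succ, Fin.val_castSucc]; omega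
    · rfl
  have hD : ∀ j σ, D j σ = ∑ p, G p σ - ∑ p, G p (σ * s j) := fun j σ => by
    rw [← Finset.sum_sub_distrib, Finset.sum_eq_single j.castSucc.succ]
    · intro p _ hp
      rw [hs j p hp, sub_self]
    · simp
  let g : Fin (m + 2) → ℝ := fun a => G 1 (swap 0 a)
  have hg : ∀ σ, G 1 σ = g (σ 0) := fun σ => by
    have := hG 1 (swap 0 (σ 0)) ((swap 0 (σ 0))⁻¹ * σ) fun k => by
      have h0 : ((swap 0 (σ 0))⁻¹ * σ) 0 = 0 := by simp
      have h1 : ∀ a : Fin (m + 2), (a : ℕ) < (1 : Fin (m + 3)) ↔ a = 0 := fun a => by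
        rw [Fin.ext_iff, Fin.val_zero, Fin.val_one, Nat.lt_one_iff]
      rw [h1, h1]
      exact ⟨fun h => (((swap 0 (σ 0))⁻¹ * σ).injective (h.trans h0.symm)), fun h => h ▸ h0⟩
    rw [mul_inv_cancel_left] at this
    exact this
  have hDg : ∀ j σ, D j σ = g (σ j.castSucc) - g (σ j.succ) := by
    intro j
    induction j using Fin.induction with
    | zero =>
      intro σ
      have h1 : (Fin.succ (Fin.castSucc (0 : Fin (m + 1)))) = (1 : Fin (m + 3)) := rfl
      simp only [D, h1, hg]
      simp [s]
    | succ j ih =>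
      intro σ
      have h : s j.succ * ρ = ρ * s j.castSucc := by
        simp only [s]
        rw [mul_swap_eq_swap_mul, hρs, Fin.succ_castSucc j, hρs]
      rw [hD, ← hrot σ, ← hrot (σ * s j.succ), mul_assoc _ _ ρ, h, ← mul_assoc, ← hD, ih, Perm.mul_apply,
        Perm.mul_apply, hρs, Fin.succ_castSucc j, hρs]
  have hswap : ∀ σ : Perm (Fin (m + 2)), g (σ 0) = g (σ 1) := by
    intro σ
    have h1 : g (σ 0) - g (σ 1) = D 0 σ := (hDg 0 σ).symm
    have h2 : s 0 * ρ = ρ * swap (Fin.last _) 0 := by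
      rw [mul_swap_eq_swap_mul, hρl]
      congr 2
    have hτ0 : (σ * ρ) 0 = σ 1 := congrArg σ (hρs 0)
    have hτl : (σ * ρ) (Fin.last _) = σ 0 := congrArg σ hρl
    rw [hD, ← hrot σ, ← hrot (σ * s 0), mul_assoc _ _ ρ, h2, ← mul_assoc, hsplit, hsplit,
      hG 0 (σ * ρ) (swap _ _) (by simp),
      hG (Fin.last _) (σ * ρ) (swap _ _) (fun k => by simp only [Fin.val_last]; omega)] at h1
    have h3 : ∀ j : Fin (m + 1), G j.castSucc.succ (σ * ρ) =
        G j.castSucc.succ (σ * ρ * swap (Fin.last _) 0) + (g (σ 1) - g (σ 0)) := by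
      intro j
      -- `u` moves the exchanged entries into the positions `j`, `j + 1`
      obtain ⟨u, hu1, hu2, hu⟩ : ∃ u : Perm (Fin (m + 2)), u j.castSucc = 0 ∧
          u j.succ = Fin.last _ ∧ ∀ k, (u k : ℕ) < (j.castSucc.succ : Fin (m + 3)) ↔
            (k : ℕ) < (j.castSucc.succ : Fin (m + 3)) := by
        have hjs : j.castSucc ≠ j.succ := Fin.castSucc_lt_succ.ne
        have hjl : j.castSucc ≠ Fin.last _ := (Fin.castSucc_lt_last j).ne
        have hl0 : Fin.last (m + 1) ≠ 0 := Fin.last_pos.ne'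
        refine ⟨swap 0 j.castSucc * swap j.succ (Fin.last _), ?_, ?_, fun k => ?_⟩
        · simp [swap_apply_of_ne_of_ne hjs hjl]
        · simp [swap_apply_of_ne_of_ne hl0 hjl.symm]
        · have := j.2
          have h0 : ((0 : Fin (m + 2)) : ℕ) = 0 := rfl
          have h1 : (Fin.last (m + 1) : ℕ) = m + 1 := rfl
          have h2 : (j.castSucc : ℕ) = j := rfl
          have h3 : (j.succ : ℕ) = j + 1 := rfl
          simp only [Perm.mul_apply, swap_apply_def, Fin.ext_iff, apply_ite Fin.val, Fin.val_succ,
            Fin.val_castSucc, Fin.val_last, Fin.val_zero]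
          split_ifs <;> first | contradiction | omega
      have h4 : swap (Fin.last _) 0 * u = u * s j := by
        simp only [s]
        rw [mul_swap_eq_swap_mul, hu1, hu2, swap_comm]
      have h5 := hDg j (σ * ρ * u)
      simp only [D] at h5
      rw [mul_assoc _ u, ← h4, ← mul_assoc, hG _ _ _ hu, hG _ _ _ hu, Perm.mul_apply _ u,
        Perm.mul_apply _ u, hu1, hu2, hτ0, hτl] at h5
      linarith
    rw [Finset.sum_congr rfl fun j _ => h3 j, Finset.sum_add_distrib, Finset.sum_const,
      Finset.card_univ, Fintype.card_fin, nsmul_eq_mul] at h1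
    push_cast at h1
    have h6 : ((m : ℝ) + 2) * (g (σ 0) - g (σ 1)) = 0 := by linear_combination h1
    have h7 : (m : ℝ) + 2 ≠ 0 := by positivity
    exact sub_eq_zero.1 ((mul_eq_zero.1 h6).resolve_left h7)
  have hconst : ∀ a b, a ≠ b → g a = g b := fun a b hab => by
    have h0 : swap 0 a b ≠ 0 := fun h => hab <| by
      rw [swap_apply_eq_iff, swap_apply_left] at h
      exact h.symm
    have := hswap (swap 0 a * swap 1 (swap 0 a b))
    simpa [swap_apply_of_ne_of_ne Fin.zero_ne_one h0.symm] using this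
  have hinv : ∀ p σ j, G p (σ * s j) = G p σ := fun p σ j => by
    by_cases hp : p = j.castSucc.succ
    · subst hp
      have h := hDg j σ
      rw [hconst _ _ fun h => Fin.castSucc_lt_succ.ne (σ.injective h), sub_self] at h
      exact (sub_eq_zero.1 h).symm
    · exact hs j p hp σ
  have htop := Perm.mclosure_swap_castSucc_succ (m + 1)
  have hmem : σ ∈ Submonoid.closure (Set.range fun i : Fin (m + 1) ↦ swap i.castSucc i.succ) := by
    rw [htop]; trivial
  induction hmem using Submonoid.closure_induction_right with
  | one => rfl
  | mul_right x hx y hy ih =>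
    obtain ⟨j, rfl⟩ := hy
    exact (hinv p x j).trans ih

/-! ### The décalage of multilinear maps -/

section Decalage

variable {V U : Type*} [AddCommGroup V] [Module ℝ V] [AddCommGroup U] [Module ℝ U]
  (𝒱 : ℤ → Submodule ℝ V) [DirectSum.Decomposition 𝒱] {𝒰 : ℤ → Submodule ℝ U}

/-- The grading involution, which multiplies elements of degree `d` by `(-1)^d`. -/
noncomputable def parity : V →ₗ[ℝ] V :=
  (DirectSum.toModule ℝ ℤ V fun d => sgn d • (𝒱 d).subtype) ∘ₗ
    (DirectSum.decomposeLinearEquiv 𝒱).toLinearMap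

variable {𝒱}

lemma parity_apply {d : ℤ} {x : V} (hx : x ∈ 𝒱 d) : parity 𝒱 x = sgn d • x := by
  rw [parity, LinearMap.comp_apply, LinearEquiv.coe_coe, DirectSum.decomposeLinearEquiv_apply,
    DirectSum.decompose_of_mem 𝒱 hx, ← DirectSum.lof_eq_of ℝ, DirectSum.toModule_lof]
  rfl

lemma neg_parity_pow_apply {d : ℤ} {x : V} (hx : x ∈ 𝒱 d) (j : ℕ) :
    ((-parity 𝒱) ^ j) x = sgn (j * (d - 1)) • x := by
  induction j with
  | zero => simp [sgn_zero]
  | succ j ih =>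
    rw [pow_succ', Module.End.mul_apply, ih, map_smul, LinearMap.neg_apply, parity_apply hx,
      ← neg_smul, smul_smul, ← neg_one_mul, ← sgn_one, ← sgn_add, ← sgn_add]
    congr 1
    exact sgn_congr (1 - d + d) (by push_cast; ring)

variable (𝒱)

/-- The multilinear map `(-1)^{∑_k (n-k)(|x_k|-1)} f(x_1, …, x_n)`. -/
noncomputable def decalageMap {n : ℕ} (f : Multi n V U) : Multi n V U :=
  f.compLinearMap fun k => (-parity 𝒱) ^ (n - 1 - (k : ℕ))

variable {𝒱}

lemma decalageMap_apply {n : ℕ} (f : Multi n V U) {d : Fin n → ℤ} {x : Fin n → V}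
    (hx : Homog 𝒱 d x) : decalageMap 𝒱 f x = sgn (decalage d) • f x := by
  have h : ∀ k : Fin n, ((-parity 𝒱) ^ (n - 1 - (k : ℕ))) (x k) =
      sgn (((n : ℤ) - 1 - k) * (d k - 1)) • x k := fun k => by
    rw [neg_parity_pow_apply (hx k)]
    have := k.2
    congr 3
    omega
  rw [decalageMap, MultilinearMap.compLinearMap_apply, funext h, MultilinearMap.map_smul_univ,
    decalage, sgn_sum]

lemma decalageMap_degree {n : ℕ} {f : Multi n V U} {k : ℤ} (hf : HasDegree 𝒱 𝒰 (k + 1 - n) f) :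
    HasDegree (shift 𝒱) (shift 𝒰) k (decalageMap 𝒱 f) := by
  intro e x hx
  have hx' : Homog 𝒱 (fun k => e k + 1) x := hx
  rw [decalageMap_apply f hx']
  have h := hf _ _ hx'
  have h' : ∑ j, (e j + 1) + (k + 1 - n) = ∑ j, e j + k + 1 := by
    rw [Finset.sum_add_distrib]
    simp
    ring
  rw [h'] at h
  exact Submodule.smul_mem _ _ h

lemma decalageMap_symm {n : ℕ} {f : Multi n V U} (hf : GradedAntisymmetric 𝒱 f) :
    GradedSymmetric (shift 𝒱) (decalageMap 𝒱 f) := by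
  intro e x hx σ
  have hx' : Homog 𝒱 (fun k => e k + 1) x := hx
  have hxσ : Homog 𝒱 (fun k => e (σ k) + 1) (x ∘ σ) := fun k => hx (σ k)
  rw [decalageMap_apply f hx', decalageMap_apply f hxσ, hf _ _ hx' σ, smul_smul, smul_smul,
    koszul_mul_sgn_decalage]

end Decalage

/-! ### The homological vector field and the map of dg-manifolds -/

section Encode

variable {V V' U : Type*} [AddCommGroup V] [Module ℝ V] [AddCommGroup V'] [Module ℝ V']
  [AddCommGroup U] [Module ℝ U]
  {𝒱 : ℤ → Submodule ℝ V} [DirectSum.Decomposition 𝒱]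
  {𝒱' : ℤ → Submodule ℝ V'}

/-- The vector field on `V[1]` that encodes the brackets. -/
noncomputable def LInfinityAlgebra.field (L : LInfinityAlgebra 𝒱) :
    FormalVectorField (shift 𝒱) 1 where
  coeff n := -decalageMap 𝒱 (L.μ n)
  degree n := by
    have h := decalageMap_degree (k := 1) (by simpa [one_add_one_eq_two] using L.degree n)
    exact fun d x hx => Submodule.neg_mem _ (h d x hx)
  symm n d x hx σ := by
    rw [neg_apply, neg_apply, smul_neg,
      ← decalageMap_symm (L.antisymm n) d x hx σ]

/-- The map `V[1] → V'[1]` that encodes a morphism. -/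
noncomputable def LInfinityMorphism.map {L : LInfinityAlgebra 𝒱} {L' : LInfinityAlgebra 𝒱'}
    (π : LInfinityMorphism L L') : FormalMap (shift 𝒱) (shift 𝒱') where
  coeff n := decalageMap 𝒱 (π.π n)
  coeff_zero := by
    rw [π.π_zero]
    ext x
    simp [decalageMap]
  degree n := decalageMap_degree (k := 0) (by simpa using π.degree n)
  symm n := decalageMap_symm (π.antisymm n)

lemma field_apply (L : LInfinityAlgebra 𝒱) {n : ℕ} {d : Fin n → ℤ} {x : Fin n → V}
    (hx : Homog 𝒱 d x) : L.field.coeff n x = -(sgn (decalage d) • L.μ n x) := by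
  rw [← decalageMap_apply _ hx]
  rfl

lemma map_apply {L : LInfinityAlgebra 𝒱} {L' : LInfinityAlgebra 𝒱'}
    (π : LInfinityMorphism L L') {n : ℕ} {d : Fin n → ℤ} {x : Fin n → V}
    (hx : Homog 𝒱 d x) : π.map.coeff n x = sgn (decalage d) • π.π n x :=
  decalageMap_apply _ hx

lemma koszul_eq_mul_koszulAnti {n : ℕ} (e : Fin n → ℤ) (σ : Perm (Fin n)) :
    koszul e σ = sgn (decalage fun k => e k + 1) * koszulAnti (fun k => e k + 1) σ *
      sgn (decalage fun k => e (σ k) + 1) := by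
  rw [← koszul_mul_sgn_decalage, mul_assoc, sgn_mul_self, mul_one]

/-- The décalage signs of inserting a bracket of the first `i` arguments leave exactly the sign of
the homotopy Jacobi and morphism identities. -/
lemma decalage_insert {n : ℕ} (e : Fin n → ℤ) (i : Fin (n + 1)) :
    sgn (decalage fun k => e k + 1) * sgn (decalage (firstPart (fun k => e k + 1) i)) *
      sgn (decalage (Fin.cons (∑ k, firstPart e i k + 2) (lastPart (fun k => e k + 1) i) :
        Fin (n - i + 1) → ℤ)) = sgn ((n : ℤ) - i) := by
  have hi := i.2
  rw [← sgn_add, ← sgn_add]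
  refine sgn_congr (∑ k, firstPart (fun k => ((n : ℤ) - 1 - k) * e k) i k +
    ∑ k, lastPart (fun k => ((n : ℤ) - 1 - k) * e k) i k) ?_
  rw [decalage, decalage, decalage, Fin.sum_univ_succ, sum_split i]
  simp only [firstPart, lastPart, Fin.cons_zero, Fin.cons_succ, Fin.val_zero, Fin.val_succ,
    add_sub_cancel_right]
  push_cast [Nat.cast_sub (Nat.lt_succ_iff.1 hi)]
  have h1 : ∑ k : Fin (n - (i : ℕ)), ((n : ℤ) - i + 1 - 1 - (k + 1)) * e ⟨i + k, by omega⟩ =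
      ∑ k : Fin (n - (i : ℕ)), ((n : ℤ) - 1 - (i + k)) * e ⟨i + k, by omega⟩ :=
    Finset.sum_congr rfl fun k _ => by ring
  have h2 : ∑ k : Fin (i : ℕ), ((i : ℤ) - 1 - k) * e ⟨k, by omega⟩ =
      ∑ k : Fin (i : ℕ), ((n : ℤ) - 1 - k) * e ⟨k, by omega⟩ -
        ((n : ℤ) - i) * ∑ k : Fin (i : ℕ), e ⟨k, by omega⟩ := by
    rw [Finset.mul_sum, ← Finset.sum_sub_distrib]
    exact Finset.sum_congr rfl fun k _ => by ring
  rw [h1, h2]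
  ring

/-- The derivative of the décalage of `f` along the vector field of the brackets. -/
lemma derivAlong_field (L : LInfinityAlgebra 𝒱) (f : ∀ n : ℕ, Multi n V U) {n : ℕ}
    (e : Fin n → ℤ) (x : Fin n → V) (hx : Homog (shift 𝒱) e x) :
    derivAlong L.field (fun n => decalageMap 𝒱 (f n)) e x =
      -(sgn (decalage fun k => e k + 1) • ∑ i : Fin (n + 1), ∑ σ : Perm (Fin n),
      (sgn ((n : ℤ) - i) * koszulAnti (fun k => e k + 1) σ /
          (((i : ℕ)! : ℝ) * ((n - (i : ℕ))! : ℝ))) •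
        f (n - i + 1)
          (Fin.cons (L.μ i (firstPart (x ∘ σ) i)) (lastPart (x ∘ σ) i) : Fin (n - i + 1) → V)) := by
  rw [derivAlong, Finset.smul_sum, ← Finset.sum_neg_distrib]
  refine Finset.sum_congr rfl fun i _ => ?_
  rw [Finset.smul_sum, ← Finset.sum_neg_distrib]
  refine Finset.sum_congr rfl fun σ _ => ?_
  have hxσ : Homog 𝒱 (fun k => e (σ k) + 1) (x ∘ σ) := fun k => hx (σ k)
  have h₁ : Homog 𝒱 (firstPart (fun k => e (σ k) + 1) i) (firstPart (x ∘ σ) i) := fun k => hxσ _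
  have h₂ : Homog 𝒱 (Fin.cons (∑ k, firstPart (e ∘ σ) i k + 2)
      (lastPart (fun k => e (σ k) + 1) i) : Fin (n - i + 1) → ℤ)
      (Fin.cons (L.μ i (firstPart (x ∘ σ) i)) (lastPart (x ∘ σ) i) : Fin (n - i + 1) → V) := by
    refine Fin.cases ?_ fun k => ?_
    · have := L.degree i _ _ h₁
      have h' : ∑ k, firstPart (fun k => e (σ k) + 1) i k + (2 - ((i : ℕ) : ℤ)) =
          ∑ k, firstPart (e ∘ σ) i k + 2 := by
        simp only [firstPart, Finset.sum_add_distrib]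
        simp
      rw [h'] at this
      simpa using this
    · rw [Fin.cons_succ, Fin.cons_succ]
      exact hxσ _
  rw [field_apply L h₁, ← neg_smul, MultilinearMap.cons_smul, decalageMap_apply _ h₂, smul_smul,
    smul_smul, smul_smul, ← neg_smul, koszul_eq_mul_koszulAnti, ← decalage_insert (e ∘ σ) i]
  congr 1
  have h3 := sgn_mul_self (decalage fun k => e (σ k) + 1)
  simp only [Function.comp]
  ring

lemma field_isHomological (L : LInfinityAlgebra 𝒱) : L.field.IsHomological := by
  intro n d x hx
  have h : L.field.coeff = fun n => decalageMap 𝒱 (-(L.μ n)) := rfl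
  rw [h, derivAlong_field L _ d x hx]
  simp only [neg_apply, smul_neg, Finset.sum_neg_distrib]
  rw [L.jacobi n _ x hx]
  simp

lemma sum_blocks {n : ℕ} (c : Composition n) {M : Type*} [AddCommMonoid M] (f : Fin n → M) :
    ∑ k, f k = ∑ m, ∑ r, f (c.embedding m r) := by
  rw [← c.blocksFinEquiv.sum_comp, Fintype.sum_sigma]
  rfl

lemma sum_blocksFun_sub_one {n : ℕ} (c : Composition n) {j : ℕ} (hj : j ≤ c.length) :
    ∑ m : Fin c.length, (if (m : ℕ) < j then (c.blocksFun m : ℤ) - 1 else 0) =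
      c.sizeUpTo j - j := by
  induction j with
  | zero => simp
  | succ j ih =>
    have h : ∀ m : Fin c.length, (if (m : ℕ) < j + 1 then (c.blocksFun m : ℤ) - 1 else 0) =
        (if (m : ℕ) < j then (c.blocksFun m : ℤ) - 1 else 0) +
          if m = ⟨j, hj⟩ then (c.blocksFun m : ℤ) - 1 else 0 := fun m => by
      simp only [Fin.ext_iff]
      split_ifs <;> omega
    rw [Finset.sum_congr rfl fun m _ => h m, Finset.sum_add_distrib, ih (by omega),
      Finset.sum_ite_eq' Finset.univ, if_pos (Finset.mem_univ _), c.sizeUpTo_succ' ⟨j, hj⟩]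
    push_cast
    ring

lemma sum_blocksFun_sub_one_gt {n : ℕ} (c : Composition n) (m : Fin c.length) :
    ∑ m' : Fin c.length, (if m < m' then (c.blocksFun m' : ℤ) - 1 else 0) =
      (n : ℤ) - c.length - (c.sizeUpTo m + c.blocksFun m - (m + 1)) := by
  have h₁ := sum_blocksFun_sub_one c (j := m + 1) m.2
  have h₂ := sum_blocksFun_sub_one c le_rfl
  rw [c.sizeUpTo_length] at h₂
  rw [c.sizeUpTo_succ'] at h₁
  push_cast at h₁
  rw [← h₁, ← h₂, ← Finset.sum_sub_distrib]
  refine Finset.sum_congr rfl fun m' _ => ?_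
  have := m'.2
  simp only [Fin.lt_def]
  split_ifs <;> omega

lemma embedding_lt_sizeUpTo {n : ℕ} (c : Composition n) (m m' : Fin c.length)
    (r : Fin (c.blocksFun m)) : (c.embedding m r : ℕ) < c.sizeUpTo m' ↔ m < m' := by
  rw [c.coe_embedding]
  constructor
  · intro h
    by_contra h'
    have := c.monotone_sizeUpTo (not_lt.1 h' : (m' : ℕ) ≤ m)
    omega
  · intro h
    have := c.monotone_sizeUpTo (Nat.succ_le_of_lt h : (m : ℕ) + 1 ≤ m')
    rw [c.sizeUpTo_succ'] at this
    have := r.2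
    omega

/-- The décalage signs of applying a map to the values on the blocks of `c` leave exactly the sign
`(-1)^ζ` of the morphism identities. -/
lemma decalage_blocks {n : ℕ} (c : Composition n) (e : Fin n → ℤ) :
    sgn (decalage fun k => e k + 1) * (∏ m, sgn (decalage fun r => e (c.embedding m r) + 1)) *
      sgn (decalage fun m => ∑ r, e (c.embedding m r) + 1) =
    sgn (blockExponent c fun k => e k + 1) := by
  rw [← sgn_sum, ← sgn_add, ← sgn_add]
  have h : blockExponent c (fun k => e k + 1) = ∑ m, ∑ r, e (c.embedding m r) *
      ((n : ℤ) - c.length - (c.sizeUpTo m + c.blocksFun m - (m + 1))) := by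
    simp only [← sum_blocksFun_sub_one_gt, Finset.mul_sum]
    rw [blockExponent]
    simp only [add_sub_cancel_right, Finset.mul_sum]
    rw [Finset.sum_congr rfl fun m _ => sum_blocks c _]
    simp only [embedding_lt_sizeUpTo]
    rw [Finset.sum_comm]
    refine Finset.sum_congr rfl fun m _ => ?_
    rw [Finset.sum_comm]
    refine Finset.sum_congr rfl fun r _ => Finset.sum_congr rfl fun m' _ => ?_
    split_ifs <;> ring
  refine sgn_congr (∑ m, ∑ r, e (c.embedding m r) *
    ((c.blocksFun m : ℤ) - 1 - r + c.length - 1 - m)) ?_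
  rw [h, decalage, sum_blocks c]
  simp only [decalage, add_sub_cancel_right, Finset.mul_sum, ← Finset.sum_add_distrib,
    c.coe_embedding]
  refine Finset.sum_congr rfl fun m _ => Finset.sum_congr rfl fun r _ => ?_
  push_cast
  ring

lemma map_relates [DirectSum.Decomposition 𝒱'] {L : LInfinityAlgebra 𝒱} {L' : LInfinityAlgebra 𝒱'}
    (π : LInfinityMorphism L L') : π.map.Relates L.field L'.field := by
  intro n e x hx
  have h : π.map.coeff = fun n => decalageMap 𝒱 (π.π n) := rfl
  rw [h, derivAlong_field L _ e x hx, π.compat n _ x hx, compAlong, Finset.smul_sum,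
    ← Finset.sum_neg_distrib]
  refine Finset.sum_congr rfl fun c _ => ?_
  rw [Finset.smul_sum, ← Finset.sum_neg_distrib]
  refine Finset.sum_congr rfl fun σ _ => ?_
  have h₁ : ∀ m, Homog 𝒱 (fun r => e (σ (c.embedding m r)) + 1) (x ∘ σ ∘ c.embedding m) :=
    fun m k => hx _
  have h₂ : Homog 𝒱' (fun m => ∑ r, e (σ (c.embedding m r)) + 1)
      (fun m => π.π (c.blocksFun m) (x ∘ σ ∘ c.embedding m)) := fun m => by
    have := π.degree _ _ _ (h₁ m)
    rw [Finset.sum_add_distrib] at this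
    simpa [add_assoc] using this
  simp only [map_apply π (h₁ _)]
  rw [MultilinearMap.map_smul_univ, field_apply L' h₂, smul_neg, smul_neg, smul_smul, smul_smul,
    smul_smul, koszul_eq_mul_koszulAnti]
  have h₃ := decalage_blocks c (e ∘ σ)
  simp only [Function.comp] at h₃
  have h₄ : (fun k => e k + 1) ∘ σ = fun k => e (σ k) + 1 := rfl
  rw [h₄, ← h₃]
  congr 2
  ring

end Encode

/-! ### Constant two-forms -/

section ConstantForms

variable {W U : Type*} [AddCommGroup W] [Module ℝ W] [AddCommGroup U] [Module ℝ U]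
  {𝒲 : ℤ → Submodule ℝ W} {𝒰 : ℤ → Submodule ℝ U} {k : ℤ}

lemma Homog.cons {n : ℕ} {a : ℤ} {v : W} {d : Fin n → ℤ} {x : Fin n → W} (hv : v ∈ 𝒲 a)
    (hx : Homog 𝒲 d x) :
    Homog 𝒲 (Fin.cons a d : Fin (n + 1) → ℤ) (Fin.cons v x : Fin (n + 1) → W) :=
  Fin.cases hv hx

/-- The constant two-form with value `B` at the origin. The factor that cuts off the higher Taylor
coefficients is the empty product in the coefficient of order `0`, and a product of zeros in all
others. -/
noncomputable def constForm (k : ℤ) (B : W →ₗ[ℝ] W →ₗ[ℝ] ℝ) (hdeg : FormHasDegree 𝒲 k B)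
    (hanti : ∀ a b v w, v ∈ 𝒲 a → w ∈ 𝒲 b → B v w = -(sgn (a * b) * B w v)) :
    TwoForm 𝒲 k where
  coeff n := B.compr₂ (LinearMap.toSpanSingleton ℝ _
    ((MultilinearMap.mkPiAlgebra ℝ (Fin n) ℝ).compLinearMap fun _ => 0))
  degree n a b d v w x hv hw _ h := by
    cases n with
    | zero => simp [hdeg a b v w hv hw (by simpa using h)]
    | succ n => simp
  antisymm n a b v w hv hw := by
    ext x
    simp [hanti a b v w hv hw]
    ring
  symm n v w d x _ σ := by
    cases n with
    | zero => simp [koszul]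
    | succ n => simp

/-- The two-form `ω` is constant with value `B`. -/
def TwoForm.HasValue (ω : TwoForm 𝒲 k) (B : W →ₗ[ℝ] W →ₗ[ℝ] ℝ) : Prop :=
  ∀ (n : ℕ) (v w : W) (x : Fin n → W), ω.coeff n v w x = if n = 0 then B v w else 0

lemma constForm_hasValue (B : W →ₗ[ℝ] W →ₗ[ℝ] ℝ) (hdeg : FormHasDegree 𝒲 k B)
    (hanti : ∀ a b v w, v ∈ 𝒲 a → w ∈ 𝒲 b → B v w = -(sgn (a * b) * B w v)) :
    (constForm k B hdeg hanti).HasValue B := by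
  intro n v w x
  cases n <;> simp [constForm]

lemma TwoForm.HasValue.isConstant {ω : TwoForm 𝒲 k} {B : W →ₗ[ℝ] W →ₗ[ℝ] ℝ}
    (h : ω.HasValue B) : ω.IsConstant := by
  intro n hn
  ext v w x
  simp [h n v w x, hn.ne']

lemma TwoForm.HasValue.isClosed {ω : TwoForm 𝒲 k} {B : W →ₗ[ℝ] W →ₗ[ℝ] ℝ}
    (h : ω.HasValue B) : ω.IsClosed := by
  intro n a b c d u v w x _ _ _ _
  simp [h (n + 1) _ _ _]

lemma TwoForm.HasValue.antisymm {ω : TwoForm 𝒲 k} {B : W →ₗ[ℝ] W →ₗ[ℝ] ℝ}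
    (h : ω.HasValue B) {a b : ℤ} {v w : W} (hv : v ∈ 𝒲 a) (hw : w ∈ 𝒲 b) :
    B v w = -(sgn (a * b) * B w v) := by
  have h₁ := h 0 v w Fin.elim0
  rw [ω.antisymm 0 a b v w hv hw] at h₁
  simpa [h 0 w v Fin.elim0] using h₁.symm

/-- The contraction `(-1)^{|y_0|} B(y_0, Q_m(y_1, …, y_m))` of a constant two-form with a vector
field. -/
noncomputable def contraction (Q : FormalVectorField 𝒲 1) (B : W →ₗ[ℝ] W →ₗ[ℝ] ℝ) {m : ℕ}
    (e : Fin (m + 1) → ℤ) (y : Fin (m + 1) → W) : ℝ :=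
  sgn (e 0) * B (y 0) (Q.coeff m fun k => y k.succ)

lemma contraction_comp_perm (Q : FormalVectorField 𝒲 1) (B : W →ₗ[ℝ] W →ₗ[ℝ] ℝ) {m : ℕ}
    {e : Fin (m + 1) → ℤ} {y : Fin (m + 1) → W} (hy : Homog 𝒲 e y) {τ : Perm (Fin (m + 1))}
    (hτ : τ 0 = 0) :
    contraction Q B e y = koszul e τ * contraction Q B (e ∘ τ) (y ∘ τ) := by
  obtain ⟨σ, hσ⟩ := exists_perm_tail hτ
  have h := Q.symm m (fun k => e k.succ) (fun k => y k.succ) (fun k => hy _) σ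
  rw [koszul_of_fix_zero hτ hσ, contraction, contraction, h]
  simp only [Function.comp_def, hτ, hσ, map_smul, smul_eq_mul]
  ring

/-- Up to the Koszul sign, a permuted contraction depends only on its first entry. -/
lemma contraction_eq_of_apply_zero (Q : FormalVectorField 𝒲 1) (B : W →ₗ[ℝ] W →ₗ[ℝ] ℝ) {m : ℕ}
    {e : Fin (m + 1) → ℤ} {y : Fin (m + 1) → W} (hy : Homog 𝒲 e y) {τ σ : Perm (Fin (m + 1))}
    (hτ : τ 0 = σ 0) :
    koszul e τ * contraction Q B (e ∘ τ) (y ∘ τ) =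
      koszul e σ * contraction Q B (e ∘ σ) (y ∘ σ) := by
  have h := contraction_comp_perm Q B (e := e ∘ σ) (y := y ∘ σ) (fun k => hy _)
    (τ := σ⁻¹ * τ) (by simp [hτ])
  have h₁ : ∀ {α : Type _} (f : Fin (m + 1) → α), (f ∘ σ) ∘ (σ⁻¹ * τ : Perm _) = f ∘ τ :=
    fun f => by funext k; simp
  have h₂ : (y ∘ σ) ∘ (σ⁻¹ * τ : Perm _) = y ∘ τ := by funext k; simp
  rw [h₁, h₂] at h
  rw [h, ← mul_assoc, ← koszul_mul, mul_inv_cancel_left]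

/-- The average over all permutations. -/
lemma sum_perm_div_factorial (n : ℕ) (r : ℝ) : ∑ _σ : Perm (Fin n), r / (n ! : ℝ) = r := by
  rw [Finset.sum_const, Finset.card_univ, Fintype.card_perm, Fintype.card_fin, nsmul_eq_mul]
  field_simp

lemma coeff_cons_perm {f : Multi (n + 1) W U} (hf : GradedSymmetric 𝒲 f) {a : ℤ} {v : W}
    {d : Fin n → ℤ} {x : Fin n → W} (hv : v ∈ 𝒲 a) (hx : Homog 𝒲 d x) (σ : Perm (Fin n)) :
    koszul d σ • f (Fin.cons v (x ∘ σ) : Fin (n + 1) → W) = f (Fin.cons v x : Fin (n + 1) → W) := by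
  obtain ⟨τ, h0, hs⟩ := exists_perm_cons σ
  have hvx : Homog 𝒲 (Fin.cons a d : Fin (n + 1) → ℤ) (Fin.cons v x : Fin (n + 1) → W) :=
    hx.cons hv
  rw [hf _ _ hvx τ, koszul_of_fix_zero h0 hs]
  congr 2
  refine funext <| Fin.cases ?_ fun k => ?_
  · simp [h0]
  · simp [hs]

/-- The Lie derivative of a constant two-form. -/
lemma TwoForm.HasValue.lieDerivative_eq {ω : TwoForm 𝒲 k} {B : W →ₗ[ℝ] W →ₗ[ℝ] ℝ}
    (h : ω.HasValue B) (Q : FormalVectorField 𝒲 1) {n : ℕ} {a b : ℤ} {d : Fin n → ℤ} {v w : W}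
    {x : Fin n → W} (hv : v ∈ 𝒲 a) (hw : w ∈ 𝒲 b) (hx : Homog 𝒲 d x) :
    lieDerivative Q ω a b d v w x = sgn k *
      (contraction Q B (Fin.cons a (Fin.cons b d)) (Fin.cons v (Fin.cons w x)) -
        sgn (a * b) *
          contraction Q B (Fin.cons b (Fin.cons a d)) (Fin.cons w (Fin.cons v x))) := by
  have hvx : Homog 𝒲 (Fin.cons a d : Fin (n + 1) → ℤ) (Fin.cons v x : Fin (n + 1) → W) :=
    hx.cons hv
  have hQ := Q.degree _ _ _ hvx
  rw [Fin.sum_univ_succ] at hQ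
  simp only [Fin.cons_zero, Fin.cons_succ] at hQ
  have key : lieDerivative Q ω a b d v w x = sgn k *
      (sgn (b * ∑ r, d r) * B (Q.coeff (n + 1) (Fin.cons v x : Fin (n + 1) → W)) w +
        sgn a * B v (Q.coeff (n + 1) (Fin.cons w x : Fin (n + 1) → W))) := by
    rw [lieDerivative, one_mul]
    congr 1
    -- only the terms with all arguments in the vector field survive
    rw [Fin.sum_univ_castSucc, Finset.sum_eq_zero, zero_add]
    · rw [← sum_perm_div_factorial n (sgn _ * _ + _)]
      refine Finset.sum_congr rfl fun σ _ => ?_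
      have hσ : ∑ r, firstPart (d ∘ σ) (Fin.last n) r = ∑ r, d r := Equiv.sum_comp σ d
      rw [hσ, h, h, h, if_pos (by simp), if_pos (by simp), if_neg (by simp),
        ← coeff_cons_perm (Q.symm _) hv hx σ, ← coeff_cons_perm (Q.symm _) hw hx σ]
      have h1 : firstPart (x ∘ σ) (Fin.last n) = x ∘ σ := rfl
      have h2 : (((n - (Fin.last n : ℕ))! : ℕ) : ℝ) = 1 := by simp
      rw [h2]
      simp only [map_smul, LinearMap.smul_apply, smul_eq_mul, one_mul, Fin.val_last, mul_one,
        mul_zero, add_zero]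
      rw [h1]
      ring
    · intro i _
      have hi := i.2
      refine Finset.sum_eq_zero fun σ _ => ?_
      rw [h, h, h, if_neg, if_neg, if_neg] <;> simp <;> omega
  rw [key, h.antisymm hQ hw, contraction, contraction]
  simp only [Fin.cons_zero, Fin.cons_succ]
  have h3 : sgn (b * ∑ r, d r) * sgn ((a + ∑ r, d r + 1) * b) = sgn (a * b) * sgn b := by
    rw [← sgn_add, ← sgn_add]
    exact sgn_congr (b * ∑ r, d r) (by ring)
  linear_combination (-sgn k * B w (Q.coeff (n + 1) (Fin.cons v x : Fin (n + 1) → W))) * h3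

/-- The pullback of a constant two-form. -/
lemma TwoForm.HasValue.pullback_eq {ω : TwoForm 𝒰 k} {B : U →ₗ[ℝ] U →ₗ[ℝ] ℝ}
    (h : ω.HasValue B) (Φ : FormalMap 𝒲 𝒰) {n : ℕ} (b : ℤ) (d : Fin n → ℤ) (v w : W)
    (x : Fin n → W) :
    pullback Φ ω b d v w x = ∑ i : Fin (n + 1), ∑ σ : Perm (Fin n),
      koszul d σ * sgn (b * ∑ r, firstPart (d ∘ σ) i r) /
        (((i : ℕ)! : ℝ) * ((n - (i : ℕ))! : ℝ)) *
      B (Φ.coeff (i + 1) (Fin.cons v (firstPart (x ∘ σ) i) : Fin ((i : ℕ) + 1) → W))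
        (Φ.coeff (n - i + 1)
          (Fin.cons w (lastPart (x ∘ σ) i) : Fin (n - (i : ℕ) + 1) → W)) := by
  rw [pullback]
  refine Finset.sum_congr rfl fun i _ => ?_
  rw [Fin.sum_univ_castSucc, Finset.sum_eq_zero, zero_add]
  · -- the remaining composition is that of `0`
    have hc : ∀ (l : ℕ), l = 0 → ∀ (f : Composition l → ℝ) (r : ℝ),
        (∀ c, c.length = 0 → f c = r) → ∑ c, f c = r := by
      rintro _ rfl f r hf
      rw [Finset.sum_congr rfl fun c _ => hf c (by have := c.length_le; omega)]
      simp [composition_card]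
    refine hc _ (by simp) _ _ fun c hc => Finset.sum_congr rfl fun σ _ => ?_
    have : IsEmpty (Fin c.length) := by rw [hc]; infer_instance
    have hp : ∏ m, ((c.blocksFun m)! : ℝ) = 1 := Fintype.prod_empty _
    rw [h, if_pos hc, hp, hc]
    simp only [Nat.factorial_zero, Nat.cast_one, mul_one]
    rfl
  · intro j _
    have hj := j.2
    refine Finset.sum_eq_zero fun c _ => Finset.sum_eq_zero fun σ _ => ?_
    rw [h, if_neg, mul_zero]
    rw [Composition.length_eq_zero]
    simp only [Fin.val_castSucc]
    omega

end ConstantForms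

/-! ### Cyclicity implies total symmetry -/

section Cyclic

variable {W U : Type*} [AddCommGroup W] [Module ℝ W] [AddCommGroup U] [Module ℝ U]
  {𝒲 : ℤ → Submodule ℝ W} {𝒰 : ℤ → Submodule ℝ U} {k : ℤ}

/-- Graded functions `G p` that are symmetric in the first `p` and in the remaining arguments, and
whose sum is symmetric under rotation of the arguments, are symmetric in all arguments. -/
theorem symm_of_rotation_invariant {m : ℕ}
    (G : Fin (m + 3) → (Fin (m + 2) → ℤ) → (Fin (m + 2) → W) → ℝ)
    (hG : ∀ (p : Fin (m + 3)) (e : Fin (m + 2) → ℤ) (y : Fin (m + 2) → W), Homog 𝒲 e y →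
      ∀ τ : Perm (Fin (m + 2)), (∀ k : Fin (m + 2), (τ k : ℕ) < p ↔ (k : ℕ) < p) →
        G p e y = koszul e τ * G p (e ∘ τ) (y ∘ τ))
    (hrot : ∀ (e : Fin (m + 2) → ℤ) (y : Fin (m + 2) → W), Homog 𝒲 e y →
      ∑ p, G p e y = koszul e (finRotate (m + 2)) *
        ∑ p, G p (e ∘ finRotate (m + 2)) (y ∘ finRotate (m + 2)))
    (p : Fin (m + 3)) {e : Fin (m + 2) → ℤ} {y : Fin (m + 2) → W} (hy : Homog 𝒲 e y)
    (σ : Perm (Fin (m + 2))) :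
    koszul e σ * G p (e ∘ σ) (y ∘ σ) = G p e y := by
  have h := const_of_rotation_invariant (fun p σ => koszul e σ * G p (e ∘ σ) (y ∘ σ))
    (fun p σ τ hτ => ?_) (fun σ => ?_) p σ
  · simpa [koszul_one] using h
  · rw [hG p (e ∘ σ) (y ∘ σ) (fun k => hy _) τ hτ, koszul_mul, mul_assoc]
    rfl
  · simp only [← Finset.mul_sum]
    rw [hrot (e ∘ σ) (y ∘ σ) (fun k => hy _), koszul_mul, mul_assoc]
    rfl

lemma cons_cons_comp_swap {α : Type*} {n : ℕ} (a b : α) (x : Fin n → α) :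
    (Fin.cons a (Fin.cons b x) : Fin (n + 2) → α) ∘ Equiv.swap 0 1 =
      Fin.cons b (Fin.cons a x) := by
  refine funext <| Fin.cases rfl <| Fin.cases rfl fun k => ?_
  simp [Equiv.swap_apply_of_ne_of_ne, Fin.ext_iff]

/-- A constant two-form is invariant under a vector field if its contraction with it is cyclic. -/
theorem TwoForm.HasValue.lieDerivative_eq_zero {ω : TwoForm 𝒲 k} {B : W →ₗ[ℝ] W →ₗ[ℝ] ℝ}
    (hω : ω.HasValue B) {Q : FormalVectorField 𝒲 1}
    (hrot : ∀ (m : ℕ) (e : Fin (m + 2) → ℤ) (y : Fin (m + 2) → W), Homog 𝒲 e y →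
      contraction Q B e y = koszul e (finRotate (m + 2)) *
        contraction Q B (e ∘ finRotate (m + 2)) (y ∘ finRotate (m + 2)))
    {n : ℕ} {a b : ℤ} {d : Fin n → ℤ} {v w : W} {x : Fin n → W} (hv : v ∈ 𝒲 a) (hw : w ∈ 𝒲 b)
    (hx : Homog 𝒲 d x) : lieDerivative Q ω a b d v w x = 0 := by
  have h := symm_of_rotation_invariant (𝒲 := 𝒲) (m := n)
    (fun p e y => if (p : ℕ) = 1 then contraction Q B e y else 0) (fun p e y hy τ hτ => ?_)
    (fun e y hy => ?_) 1 ((hx.cons hw).cons hv) (Equiv.swap 0 1)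
  · simp only [Fin.val_one, if_true] at h
    rw [koszul_swap_zero_one, cons_cons_comp_swap, cons_cons_comp_swap] at h
    rw [hω.lieDerivative_eq Q hv hw hx, ← h]
    simp
  · split_ifs with hp
    · have h0 := hτ 0
      rw [hp] at h0
      exact contraction_comp_perm Q B hy (Fin.ext (by simpa using h0))
    · simp
  · have hsum : ∀ r : ℝ, ∑ p : Fin (n + 3), (if (p : ℕ) = 1 then r else 0) = r := fun r => by
      rw [Finset.sum_eq_single (1 : Fin (n + 3)), if_pos (Fin.val_one _)]
      · exact fun p _ hp => if_neg fun h => hp (Fin.ext (h.trans (Fin.val_one _).symm))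
      · simp
    rw [hsum, hsum]
    exact hrot n e y hy

/-- The pairing `± b(Φ_p(y_1, …, y_p), Φ_{n-p}(y_{p+1}, …, y_n))` of Taylor coefficients of `Φ`. -/
noncomputable def pairing (Φ : FormalMap 𝒲 𝒰) (b : U →ₗ[ℝ] U →ₗ[ℝ] ℝ) {n : ℕ} (p : Fin (n + 1))
    (e : Fin n → ℤ) (y : Fin n → W) : ℝ :=
  sgn (∑ r, firstPart e p r) *
    b (Φ.coeff p (firstPart y p)) (Φ.coeff (n - p) (lastPart y p))

lemma pairing_comp_perm (Φ : FormalMap 𝒲 𝒰) (b : U →ₗ[ℝ] U →ₗ[ℝ] ℝ) {n : ℕ} (p : Fin (n + 1))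
    {e : Fin n → ℤ} {y : Fin n → W} (hy : Homog 𝒲 e y) {τ : Perm (Fin n)}
    (hτ : ∀ k, (τ k : ℕ) < p ↔ (k : ℕ) < p) :
    pairing Φ b p e y = koszul e τ * pairing Φ b p (e ∘ τ) (y ∘ τ) := by
  obtain ⟨τ₁, τ₂, h₁, h₂, h₃⟩ := exists_perm_parts p τ hτ
  have e₁ : firstPart (e ∘ τ) p = firstPart e p ∘ τ₁ := congrArg (e ∘ ·) h₁
  have y₁ : firstPart (y ∘ τ) p = firstPart y p ∘ τ₁ := congrArg (y ∘ ·) h₁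
  have y₂ : lastPart (y ∘ τ) p = lastPart y p ∘ τ₂ := congrArg (y ∘ ·) h₂
  have s₁ := Φ.symm p (firstPart e p) (firstPart y p) (fun k => hy _) τ₁
  have s₂ := Φ.symm (n - p) (lastPart e p) (lastPart y p) (fun k => hy _) τ₂
  have hs : ∑ r, (firstPart e p ∘ τ₁) r = ∑ r, firstPart e p r := Equiv.sum_comp τ₁ _
  rw [pairing, pairing, e₁, y₁, y₂, hs, s₁, s₂, h₃]
  simp only [map_smul, LinearMap.smul_apply, smul_eq_mul]
  ring

lemma coeff_comp_cast (Φ : FormalMap 𝒲 𝒰) {m n : ℕ} (h : m = n) (y : Fin n → W) :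
    Φ.coeff m (y ∘ Fin.cast h) = Φ.coeff n y := by
  subst h
  rfl

/-- The summands of the cyclic brackets, with the contraction moved into the summand that splits
off one argument. -/
noncomputable def bracketTerm (Q : FormalVectorField 𝒲 1) (B : W →ₗ[ℝ] W →ₗ[ℝ] ℝ)
    (Φ : FormalMap 𝒲 𝒰) (b : U →ₗ[ℝ] U →ₗ[ℝ] ℝ) {m : ℕ} (p : Fin (m + 3))
    (e : Fin (m + 2) → ℤ) (y : Fin (m + 2) → W) : ℝ :=
  pairing Φ b p e y + if (p : ℕ) = 1 then contraction Q B e y else 0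

lemma sum_bracketTerm (Q : FormalVectorField 𝒲 1) (B : W →ₗ[ℝ] W →ₗ[ℝ] ℝ)
    (Φ : FormalMap 𝒲 𝒰) (b : U →ₗ[ℝ] U →ₗ[ℝ] ℝ) {m : ℕ}
    (e : Fin (m + 2) → ℤ) (y : Fin (m + 2) → W) :
    ∑ p, bracketTerm Q B Φ b p e y = contraction Q B e y + ∑ p, pairing Φ b p e y := by
  simp only [bracketTerm]
  rw [Finset.sum_add_distrib, add_comm]
  congr 1
  rw [Finset.sum_eq_single (1 : Fin (m + 3)), if_pos (Fin.val_one _)]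
  · intro p _ hp
    rw [if_neg fun h => hp (Fin.ext (h.trans (Fin.val_one _).symm))]
  · simp

/-- If the sum of contraction and pairings is cyclic, all terms are totally symmetric. -/
theorem bracketTerm_symm (Q : FormalVectorField 𝒲 1) (B : W →ₗ[ℝ] W →ₗ[ℝ] ℝ)
    (Φ : FormalMap 𝒲 𝒰) (b : U →ₗ[ℝ] U →ₗ[ℝ] ℝ) {m : ℕ}
    (hrot : ∀ (e : Fin (m + 2) → ℤ) (y : Fin (m + 2) → W), Homog 𝒲 e y →
      contraction Q B e y + ∑ p, pairing Φ b p e y = koszul e (finRotate (m + 2)) *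
        (contraction Q B (e ∘ finRotate (m + 2)) (y ∘ finRotate (m + 2)) +
          ∑ p, pairing Φ b p (e ∘ finRotate (m + 2)) (y ∘ finRotate (m + 2))))
    (p : Fin (m + 3)) {e : Fin (m + 2) → ℤ} {y : Fin (m + 2) → W} (hy : Homog 𝒲 e y)
    (σ : Perm (Fin (m + 2))) :
    koszul e σ * bracketTerm Q B Φ b p (e ∘ σ) (y ∘ σ) = bracketTerm Q B Φ b p e y := by
  refine symm_of_rotation_invariant (𝒲 := 𝒲) (bracketTerm Q B Φ b) ?_ ?_ p hy σ
  · intro p e y hy τ hτ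
    rw [bracketTerm, bracketTerm, pairing_comp_perm Φ b p hy hτ]
    split_ifs with hp
    · have h0 : τ 0 = 0 := by
        have := hτ 0
        rw [hp] at this
        exact Fin.ext (by simpa using this)
      rw [contraction_comp_perm Q B hy h0]
      ring
    · ring
  · intro e y hy
    rw [sum_bracketTerm, sum_bracketTerm]
    exact hrot e y hy

/-- A graded symmetric form on the values of `Φ` as a difference of two pairings, the second one
evaluated on the arguments with the two blocks exchanged by `τ`. -/
lemma exists_form_eq_pairing {Φ : FormalMap 𝒲 𝒰} {b B' : U →ₗ[ℝ] U →ₗ[ℝ] ℝ}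
    (hB' : ∀ a c X Y, X ∈ 𝒰 a → Y ∈ 𝒰 c →
      B' X Y = -(sgn a * b X Y) + sgn (a * c) * (sgn c * b Y X))
    {n : ℕ} (p : Fin (n + 1)) {e : Fin n → ℤ} {y : Fin n → W} (hy : Homog 𝒲 e y) :
    ∃ τ : Perm (Fin n), firstPart τ ⟨n - p, by omega⟩ = lastPart id p ∧
      B' (Φ.coeff p (firstPart y p)) (Φ.coeff (n - p) (lastPart y p)) =
        -pairing Φ b p e y +
          koszul e τ * pairing Φ b ⟨n - p, by omega⟩ (e ∘ τ) (y ∘ τ) := by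
  obtain ⟨τ, h₁, h₂, h₃⟩ := exists_perm_flip p
  refine ⟨τ, h₁, ?_⟩
  have e₁ : firstPart (e ∘ τ) ⟨n - p, by omega⟩ = lastPart e p := congrArg (e ∘ ·) h₁
  have y₁ : firstPart (y ∘ τ) ⟨n - p, by omega⟩ = lastPart y p := congrArg (y ∘ ·) h₁
  have y₂ : lastPart (y ∘ τ) ⟨n - p, by omega⟩ = firstPart y p ∘ Fin.cast _ :=
    congrArg (y ∘ ·) h₂
  have d₁ := Φ.degree p (firstPart e p) (firstPart y p) (fun k => hy _)
  have d₂ := Φ.degree (n - p) (lastPart e p) (lastPart y p) (fun k => hy _)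
  rw [add_zero] at d₁ d₂
  rw [hB' _ _ _ _ d₁ d₂, pairing, pairing, h₃, e₁, y₁, y₂, coeff_comp_cast]

/-- The bulk equation `𝓛_Q ω + Φ^* ω' = 0` for constant forms. All terms of the pullback that do not
split off one argument cancel, as they are totally symmetric. -/
theorem lieDerivative_add_pullback_eq_zero {Q : FormalVectorField 𝒲 1} {Φ : FormalMap 𝒲 𝒰}
    {b : U →ₗ[ℝ] U →ₗ[ℝ] ℝ} {ω : TwoForm 𝒲 (-1)} {B : W →ₗ[ℝ] W →ₗ[ℝ] ℝ} (hω : ω.HasValue B)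
    {ω' : TwoForm 𝒰 0} {B' : U →ₗ[ℝ] U →ₗ[ℝ] ℝ} (hω' : ω'.HasValue B')
    (hB' : ∀ a c X Y, X ∈ 𝒰 a → Y ∈ 𝒰 c →
      B' X Y = -(sgn a * b X Y) + sgn (a * c) * (sgn c * b Y X))
    (hrot : ∀ (m : ℕ) (e : Fin (m + 2) → ℤ) (y : Fin (m + 2) → W), Homog 𝒲 e y →
      contraction Q B e y + ∑ p, pairing Φ b p e y = koszul e (finRotate (m + 2)) *
        (contraction Q B (e ∘ finRotate (m + 2)) (y ∘ finRotate (m + 2)) +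
          ∑ p, pairing Φ b p (e ∘ finRotate (m + 2)) (y ∘ finRotate (m + 2))))
    {n : ℕ} {a c : ℤ} {d : Fin n → ℤ} {v w : W} {x : Fin n → W} (hv : v ∈ 𝒲 a) (hw : w ∈ 𝒲 c)
    (hx : Homog 𝒲 d x) :
    lieDerivative Q ω a c d v w x + pullback Φ ω' c d v w x = 0 := by
  set e : Fin (n + 2) → ℤ := Fin.cons a (Fin.cons c d)
  set y : Fin (n + 2) → W := Fin.cons v (Fin.cons w x)
  have hy : Homog 𝒲 e y := (hx.cons hw).cons hv
  let s : Perm (Fin (n + 2)) := Equiv.swap 0 1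
  have hse : e ∘ s = Fin.cons c (Fin.cons a d) := cons_cons_comp_swap _ _ _
  have hsy : y ∘ s = Fin.cons w (Fin.cons v x) := cons_cons_comp_swap _ _ _
  have hs : koszul e s = sgn (a * c) := koszul_swap_zero_one e
  set g : Fin (n + 3) → ℝ := fun p => bracketTerm Q B Φ b p e y
  set A₀ := contraction Q B e y
  set A₁ := contraction Q B (e ∘ s) (y ∘ s)
  have hterm : ∀ (i : Fin (n + 1)) (σ : Perm (Fin n)),
      koszul d σ * sgn (c * ∑ r, firstPart (d ∘ σ) i r) *
      B' (Φ.coeff (i + 1) (Fin.cons v (firstPart (x ∘ σ) i) : Fin ((i : ℕ) + 1) → W))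
        (Φ.coeff (n - i + 1)
          (Fin.cons w (lastPart (x ∘ σ) i) : Fin (n - (i : ℕ) + 1) → W)) =
      -(g i.castSucc.succ - if (i : ℕ) = 0 then A₀ else 0) +
        (g i.rev.castSucc.succ - if (i.rev : ℕ) = 0 then sgn (a * c) * A₁ else 0) := by
    intro i σ
    -- the permutation that moves `w` behind the first `i` of the permuted arguments
    obtain ⟨σ', hσ'0, hσ's⟩ := exists_perm_cons σ
    obtain ⟨τ, hτ0, hτs⟩ := exists_perm_cons (σ' * i.cycleRange)
    have hK : koszul e τ = koszul d σ * sgn (c * ∑ r, firstPart (d ∘ σ) i r) := by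
      have h : (Fin.cons c d : Fin (n + 1) → ℤ) ∘ σ' = Fin.cons c (d ∘ σ) :=
        funext <| Fin.cases (by simp [hσ'0]) fun k => by simp [hσ's]
      rw [koszul_of_fix_zero hτ0 hτs]
      change koszul (Fin.cons c d : Fin (n + 1) → ℤ) _ = _
      rw [koszul_mul, h, koszul_cycleRange, koszul_of_fix_zero hσ'0 hσ's]
      rfl
    have hzy : Homog 𝒲 (e ∘ τ) (y ∘ τ) := fun k => hy _
    have h₁ : firstPart (y ∘ τ) i.castSucc.succ =
        (Fin.cons v (firstPart (x ∘ σ) i) : Fin ((i : ℕ) + 1) → W) := by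
      refine funext <| Fin.cases (congrArg y hτ0) fun k => ?_
      have h := hτs (Fin.castSucc ⟨k, by omega⟩)
      rw [Perm.mul_apply, cycleRange_castSucc_of_lt _ _ k.2, hσ's] at h
      exact congrArg y h
    have hcast : n + 2 - ((i : ℕ) + 1) = n - i + 1 := by omega
    have h₂ : lastPart (y ∘ τ) i.castSucc.succ =
        (Fin.cons w (lastPart (x ∘ σ) i) : Fin (n - (i : ℕ) + 1) → W) ∘ Fin.cast hcast := by
      suffices h : ∀ k : Fin (n - (i : ℕ) + 1),
          lastPart (y ∘ τ) i.castSucc.succ (Fin.cast hcast.symm k) =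
            (Fin.cons w (lastPart (x ∘ σ) i) : Fin (n - (i : ℕ) + 1) → W) k from
        funext fun k => h (Fin.cast hcast k)
      refine Fin.cases ?_ fun k => ?_
      · have h := hτs i
        rw [Perm.mul_apply, Fin.cycleRange_self, hσ'0] at h
        exact congrArg y h
      · have h := hτs (Fin.succ ⟨i + k, by omega⟩)
        rw [Perm.mul_apply, cycleRange_succ_of_le _ _ (by simp), hσ's] at h
        refine (congrArg (y ∘ τ) (Fin.ext ?_)).trans (congrArg y h)
        simp
        omega
    obtain ⟨f, hf, hform⟩ := exists_form_eq_pairing (Φ := Φ) hB' i.castSucc.succ hzy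
    rw [h₁, h₂] at hform
    have hp' : (⟨n + 2 - (i.castSucc.succ : Fin (n + 3)), by omega⟩ : Fin (n + 3)) =
        i.rev.castSucc.succ := by
      ext
      simp only [Fin.val_succ, Fin.val_castSucc, Fin.val_rev]
      omega
    have hform' := (congrArg (B' _) (coeff_comp_cast Φ hcast _)).symm.trans hform
    rw [hp'] at hform'
    have hb₁ := bracketTerm_symm Q B Φ b (hrot n) i.castSucc.succ hy τ
    have hb₂ := bracketTerm_symm Q B Φ b (hrot n) i.rev.castSucc.succ hy (τ * f)
    have hA : koszul e τ * contraction Q B (e ∘ τ) (y ∘ τ) = A₀ :=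
      (contraction_comp_perm Q B hy hτ0).symm
    -- `τ * f` moves `w` to the front, which turns the contraction into the one with `v`, `w` swapped
    have hA' : koszul e (τ * f) * contraction Q B (e ∘ (τ * f : Perm _)) (y ∘ (τ * f : Perm _)) =
        sgn (a * c) * A₁ := by
      rw [← hs]
      refine contraction_eq_of_apply_zero Q B hy ?_
      have h0 : f 0 = i.succ := congrFun hf ⟨0, by simp; omega⟩
      have h1 := hτs i
      rw [Perm.mul_apply, Fin.cycleRange_self, hσ'0] at h1
      rw [Perm.mul_apply, h0, h1]
      rfl
    rw [← hK]
    refine (congrArg (koszul e τ * ·) hform').trans ?_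
    rw [koszul_mul] at hb₂ hA'
    have ep : ∀ q : Fin (n + 3), pairing Φ b q ((e ∘ τ) ∘ f) ((y ∘ τ) ∘ f) =
        pairing Φ b q (e ∘ (τ * f : Perm _)) (y ∘ (τ * f : Perm _)) := fun q => rfl
    rw [ep]
    -- the contraction is part of a pairing term exactly if one of the two blocks is empty
    by_cases hi : (i : ℕ) = 0 <;> by_cases hi' : (i.rev : ℕ) = 0 <;>
      simp only [hi, hi', if_true, if_false, g, bracketTerm, Fin.val_succ, Fin.val_castSucc,
        Nat.add_eq_right] at hb₁ hb₂ ⊢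
    · linear_combination -hb₁ + hb₂ + hA - hA'
    · linear_combination -hb₁ + hb₂ + hA
    · linear_combination -hb₁ + hb₂ - hA'
    · linear_combination -hb₁ + hb₂
  rw [hω.lieDerivative_eq Q hv hw hx, ← hse, ← hsy, hω'.pullback_eq]
  have hsum : ∀ i : Fin (n + 1), ∑ σ : Perm (Fin n),
      koszul d σ * sgn (c * ∑ r, firstPart (d ∘ σ) i r) /
        (((i : ℕ)! : ℝ) * ((n - (i : ℕ))! : ℝ)) *
      B' (Φ.coeff (i + 1) (Fin.cons v (firstPart (x ∘ σ) i) : Fin ((i : ℕ) + 1) → W))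
        (Φ.coeff (n - i + 1)
          (Fin.cons w (lastPart (x ∘ σ) i) : Fin (n - (i : ℕ) + 1) → W)) =
      (n ! : ℝ) / (((i : ℕ)! : ℝ) * ((i.rev : ℕ)! : ℝ)) *
        (-(g i.castSucc.succ - if (i : ℕ) = 0 then A₀ else 0) +
        (g i.rev.castSucc.succ - if (i.rev : ℕ) = 0 then sgn (a * c) * A₁ else 0)) := by
    intro i
    have hrev : (i.rev : ℕ) = n - i := by rw [Fin.val_rev]; omega
    rw [← sum_perm_div_factorial n ((n ! : ℝ) / _ * _)]
    refine Finset.sum_congr rfl fun σ _ => ?_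
    rw [← hterm i σ, hrev]
    have hn : (n ! : ℝ) ≠ 0 := by positivity
    have hi : ((i : ℕ)! : ℝ) ≠ 0 := by positivity
    have hi' : ((n - i : ℕ)! : ℝ) ≠ 0 := by positivity
    field_simp
  rw [Finset.sum_congr rfl fun i _ => hsum i]
  -- the totally symmetric terms cancel under exchange of the two factors
  have hcancel : ∑ i : Fin (n + 1), (n ! : ℝ) / (((i : ℕ)! : ℝ) * ((i.rev : ℕ)! : ℝ)) *
      g i.castSucc.succ = ∑ i : Fin (n + 1), (n ! : ℝ) / (((i : ℕ)! : ℝ) * ((i.rev : ℕ)! : ℝ)) *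
      g i.rev.castSucc.succ := by
    rw [← Equiv.sum_comp Fin.revPerm]
    refine Finset.sum_congr rfl fun i _ => ?_
    rw [Fin.revPerm_apply, Fin.rev_rev, mul_comm ((i.rev : ℕ)! : ℝ)]
  have h₀ : ∑ i : Fin (n + 1), (n ! : ℝ) / (((i : ℕ)! : ℝ) * ((i.rev : ℕ)! : ℝ)) *
      (if (i : ℕ) = 0 then A₀ else 0) = A₀ := by
    rw [Finset.sum_eq_single 0]
    · simp [Nat.factorial_ne_zero]
    · intro i _ hi
      rw [if_neg fun h => hi (Fin.ext (by simpa using h)), mul_zero]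
    · simp
  have h₁ : ∑ i : Fin (n + 1), (n ! : ℝ) / (((i : ℕ)! : ℝ) * ((i.rev : ℕ)! : ℝ)) *
      (if (i.rev : ℕ) = 0 then sgn (a * c) * A₁ else 0) = sgn (a * c) * A₁ := by
    rw [Finset.sum_eq_single (Fin.last n)]
    · simp [Nat.factorial_ne_zero]
    · intro i _ hi
      rw [if_neg fun h => hi ?_, mul_zero]
      ext
      rw [Fin.val_rev] at h
      rw [Fin.val_last]
      omega
    · simp
  simp only [mul_add, mul_neg, mul_sub, Finset.sum_add_distrib, Finset.sum_neg_distrib,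
    Finset.sum_sub_distrib, h₀, h₁, hcancel]
  rw [sgn_neg, sgn_one]
  ring

end Cyclic

/-! ### Cyclic brackets in shifted degrees -/

section Brackets

variable {V V' : Type*} [AddCommGroup V] [Module ℝ V] [AddCommGroup V'] [Module ℝ V']
  {𝒱 : ℤ → Submodule ℝ V} {𝒱' : ℤ → Submodule ℝ V'}

/-- With the décalage sign of the arguments after the first, a cyclic function becomes invariant
under rotation up to the Koszul sign for the shifted degrees. -/
lemma IsCyclic.rotate {m : ℕ} {F : (Fin (m + 2) → ℤ) → (Fin (m + 2) → V) → ℝ}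
    (hF : IsCyclic 𝒱 (m := m + 1) F) {e : Fin (m + 2) → ℤ} {y : Fin (m + 2) → V}
    (hy : Homog (shift 𝒱) e y) :
    sgn (decalage fun k : Fin (m + 1) => e k.succ + 1) * F (fun k => e k + 1) y =
      koszul e (finRotate (m + 2)) *
        (sgn (decalage fun k : Fin (m + 1) => e (finRotate (m + 2) k.succ) + 1) *
          F (fun k => e (finRotate (m + 2) k) + 1) (y ∘ finRotate (m + 2))) := by
  have hs : ∀ k : Fin (m + 1), finRotate (m + 2) k.castSucc = k.succ := fun k => by
    rw [finRotate_apply, Fin.coeSucc_eq_succ]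
  have hl : finRotate (m + 2) (Fin.last _) = 0 := finRotate_last
  have hK : koszul e (finRotate (m + 2)) = sgn (e 0 * ∑ k : Fin (m + 1), e k.succ) := by
    have h := koszul_cycleRange (e 0) (fun k => e k.succ) (Fin.last _)
    rw [Fin.cycleRange_last] at h
    exact (congrArg (koszul · _) (Fin.cons_self_tail e).symm).trans h
  have h := hF (fun k => e (finRotate (m + 2) k) + 1) (y ∘ finRotate (m + 2)) fun k => hy _
  have h₁ : (Fin.cons (e (finRotate (m + 2) (Fin.last _)) + 1)
      fun i : Fin (m + 1) => e (finRotate (m + 2) i.castSucc) + 1 : Fin (m + 2) → ℤ) =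
      fun k => e k + 1 :=
    funext <| Fin.cases (by simp [hl]) fun k => by simp [hs]
  have h₂ : (Fin.cons ((y ∘ finRotate (m + 2)) (Fin.last _))
      fun i : Fin (m + 1) => (y ∘ finRotate (m + 2)) i.castSucc : Fin (m + 2) → V) = y :=
    funext <| Fin.cases (by simp [hl]) fun k => by simp [hs]
  rw [h₁, h₂] at h
  rw [h, hK, ← mul_assoc, ← mul_assoc, ← sgn_add, ← sgn_add]
  congr 1
  have hρ0 : finRotate (m + 2) 0 = 1 := hs 0
  have hρs : ∀ k : Fin m, finRotate (m + 2) k.castSucc.succ = k.succ.succ := fun k => by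
    rw [Fin.succ_castSucc, hs]
  have hρl : finRotate (m + 2) (Fin.succ (Fin.last m)) = 0 := hl
  have hE : ∑ k : Fin (m + 1), e k.succ = e 1 + ∑ k : Fin m, e k.succ.succ := Fin.sum_univ_succ _
  have hd₁ : decalage (fun k : Fin (m + 1) => e k.succ + 1) =
      m * e 1 + ∑ k : Fin m, ((m : ℤ) - 1 - k) * e k.succ.succ := by
    rw [decalage, Fin.sum_univ_succ]
    simp only [add_sub_cancel_right, Fin.val_zero, Fin.val_succ, Fin.succ_zero_eq_one]
    push_cast
    congr 1
    · ring
    · exact Finset.sum_congr rfl fun k _ => by ring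
  have hd₂ : decalage (fun k : Fin (m + 1) => e (finRotate (m + 2) k.succ) + 1) =
      ∑ k : Fin m, ((m : ℤ) - 1 - k) * e k.succ.succ + ∑ k : Fin m, e k.succ.succ := by
    rw [decalage, Fin.sum_univ_castSucc, ← Finset.sum_add_distrib]
    simp only [add_sub_cancel_right, Fin.val_castSucc, Fin.val_last, hρs]
    push_cast
    rw [add_sub_cancel_right, sub_self, zero_mul, add_zero]
    exact Finset.sum_congr rfl fun k _ => by ring
  have hD : ∑ i : Fin (m + 1), (e (finRotate (m + 2) i.castSucc) + 1) =
      e 1 + ∑ k : Fin m, e k.succ.succ + (m + 1) := by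
    simp only [hs, Finset.sum_add_distrib, hE]
    simp
  simp only [hρ0, hl, hD, hd₁, hd₂, hE]
  generalize ∑ k : Fin m, e k.succ.succ = S
  generalize ∑ k : Fin m, ((m : ℤ) - 1 - k) * e k.succ.succ = T
  push_cast
  refine sgn_congr (-(e 0 * (e 1 + S)) - S - (m + 1) * (e 0 + 2) - e 1) ?_
  ring

variable [DirectSum.Decomposition 𝒱]

/-- Up to the décalage sign, the bulk bracket is the sum of the contraction of `B` with the vector
field and the pairings of the Taylor coefficients of the map. -/
lemma sgn_bulkBracket {L : LInfinityAlgebra 𝒱} {L' : LInfinityAlgebra 𝒱'}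
    (π : LInfinityMorphism L L') (b : V →ₗ[ℝ] V →ₗ[ℝ] ℝ) (b' : V' →ₗ[ℝ] V' →ₗ[ℝ] ℝ)
    {B : V →ₗ[ℝ] V →ₗ[ℝ] ℝ} (hB : ∀ d v w, v ∈ 𝒱 d → B v w = sgn d * b v w) {m : ℕ}
    {e : Fin (m + 1) → ℤ} {y : Fin (m + 1) → V} (hy : Homog (shift 𝒱) e y) :
    sgn (decalage fun k : Fin m => e k.succ + 1) * bulkBracket π b b' (fun k => e k + 1) y =
      contraction L.field B e y + ∑ p, pairing π.map b' p e y := by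
  have hy' : Homog 𝒱 (fun k => e k + 1) y := hy
  have ht : Homog 𝒱 (fun k : Fin m => e k.succ + 1) (fun k => y k.succ) := fun k => hy _
  rw [bulkBracket, contraction, hB _ _ _ (hy' 0), field_apply L ht, mul_add]
  congr 1
  · rw [map_neg, map_smul, smul_eq_mul, sgn_add, sgn_one]
    linear_combination (-sgn (decalage fun k : Fin m => e k.succ + 1) *
      b (y 0) (L.μ m fun k => y k.succ)) * sgn_mul_self (e 0)
  · rw [Finset.mul_sum]
    refine Finset.sum_congr rfl fun p _ => ?_
    have hp := p.2
    have h₁ : Homog 𝒱 (firstPart (fun k => e k + 1) p) (firstPart y p) := fun k => hy _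
    have h₂ : Homog 𝒱 (lastPart (fun k => e k + 1) p) (lastPart y p) := fun k => hy _
    rw [pairing, map_apply π h₁, map_apply π h₂, map_smul, map_smul, LinearMap.smul_apply,
      smul_eq_mul, smul_eq_mul]
    simp only [← mul_assoc, ← sgn_add]
    congr 1
    have hd : decalage (fun k : Fin m => e k.succ + 1) + m * e 0 =
        ∑ k : Fin (m + 1), ((m : ℤ) - k) * e k := by
      rw [Fin.sum_univ_succ, decalage, add_comm]
      simp only [add_sub_cancel_right, Fin.val_zero, Fin.val_succ]
      refine congrArg₂ _ (by simp) (Finset.sum_congr rfl fun k _ => ?_)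
      push_cast
      ring
    have hd' : decalage (fun k : Fin m => e k.succ + 1) =
        ∑ k : Fin (m + 1), ((m : ℤ) - k) * e k - m * e 0 := by linear_combination hd
    rw [hd', sum_split p]
    refine sgn_congr (((m : ℤ) - p) * ∑ k, firstPart e p k) ?_
    rw [decalage, decalage]
    simp only [firstPart, lastPart, add_sub_cancel_right]
    push_cast [Nat.cast_sub (Nat.lt_succ_iff.1 hp)]
    have h3 : ∑ k : Fin (p : ℕ), ((p : ℤ) - 1 - k) * e ⟨k, by omega⟩ =
        ∑ k : Fin (p : ℕ), ((m : ℤ) - k) * e ⟨k, by omega⟩ -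
          ((m : ℤ) - p + 1) * ∑ k : Fin (p : ℕ), e ⟨k, by omega⟩ := by
      rw [Finset.mul_sum, ← Finset.sum_sub_distrib]
      exact Finset.sum_congr rfl fun k _ => by ring
    have h4 : ∑ k : Fin (m + 1 - (p : ℕ)), ((m : ℤ) + 1 - p - 1 - k) * e ⟨p + k, by omega⟩ =
        ∑ k : Fin (m + 1 - (p : ℕ)), ((m : ℤ) - (p + k)) * e ⟨p + k, by omega⟩ :=
      Finset.sum_congr rfl fun k _ => by ring
    rw [h3, h4]
    ring

/-- Up to the décalage sign, the boundary bracket is the contraction of the symmetrized form with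
the vector field. -/
lemma sgn_boundaryBracket (L : LInfinityAlgebra 𝒱) (b : V →ₗ[ℝ] V →ₗ[ℝ] ℝ)
    {B : V →ₗ[ℝ] V →ₗ[ℝ] ℝ} (hB : ∀ d e v w, v ∈ 𝒱 d → w ∈ 𝒱 e →
      B v w = sgn d * (b v w + sgn (d * e) * b w v)) {m : ℕ}
    {e : Fin (m + 1) → ℤ} {y : Fin (m + 1) → V} (hy : Homog (shift 𝒱) e y) :
    sgn (decalage fun k : Fin m => e k.succ + 1) * boundaryBracket L b (fun k => e k + 1) y =
      contraction L.field B e y := by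
  have hy' : Homog 𝒱 (fun k => e k + 1) y := hy
  have ht : Homog 𝒱 (fun k : Fin m => e k.succ + 1) (fun k => y k.succ) := fun k => hy _
  rw [boundaryBracket, contraction, field_apply L ht, map_neg, map_smul,
    hB _ _ _ _ (hy' 0) (L.degree m _ _ ht), smul_eq_mul, sgn_add (e 0) 1, sgn_one]
  linear_combination (-sgn (decalage fun k : Fin m => e k.succ + 1) *
    (b (y 0) (L.μ m fun k => y k.succ) +
      sgn ((e 0 + 1) * (∑ k : Fin m, (e k.succ + 1) + (2 - m))) *
        b (L.μ m fun k => y k.succ) (y 0))) * sgn_mul_self (e 0)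

end Brackets

end RelLInfty

open RelLInfty in
theorem mainTheorem1 {V V' : Type*} [AddCommGroup V] [Module ℝ V] [AddCommGroup V'] [Module ℝ V']
    (𝒱 : ℤ → Submodule ℝ V) [DirectSum.Decomposition 𝒱]
    (𝒱' : ℤ → Submodule ℝ V') [DirectSum.Decomposition 𝒱']
    (L : RelLInfty.LInfinityAlgebra 𝒱) (L' : RelLInfty.LInfinityAlgebra 𝒱')
    (π : RelLInfty.LInfinityMorphism L L') (C : RelLInfty.CyclicStructure π) :
    ∃ P : RelLInfty.BVBFVPair (RelLInfty.shift 𝒱) (RelLInfty.shift 𝒱') (-1) 0,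
      RelLInfty.EncodesBrackets P.Q L ∧
      RelLInfty.EncodesBrackets P.Q' L' ∧
      RelLInfty.EncodesMorphism P.Φ π ∧
      P.ω.IsConstant ∧ RelLInfty.EncodesForm P.ω C.form ∧
      P.ω'.IsConstant ∧ RelLInfty.EncodesSymmetrizedForm P.ω' C.bdryForm := by
  let B : V →ₗ[ℝ] V →ₗ[ℝ] ℝ := C.form ∘ₗ parity 𝒱
  have hB : ∀ d v w, v ∈ 𝒱 d → B v w = sgn d * C.form v w := fun d v w hv => by
    simp [B, parity_apply hv]
  let B' : V' →ₗ[ℝ] V' →ₗ[ℝ] ℝ := C.bdryForm ∘ₗ parity 𝒱' + C.bdryForm.flip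
  have hB' : ∀ d e v w, v ∈ 𝒱' d → w ∈ 𝒱' e →
      B' v w = sgn d * (C.bdryForm v w + sgn (d * e) * C.bdryForm w v) := fun d e v w hv hw => by
    have h : C.bdryForm w v = sgn d * (sgn (d * e) * C.bdryForm w v) := by
      -- the form has degree `-2`, so that only `d + e = 2` contributes
      by_cases hde : e + d + -2 = 0
      · obtain ⟨r, hr⟩ := Int.even_mul_pred_self d
        rw [← mul_assoc, ← sgn_add, show e = 2 - d by linarith,
          sgn_congr (b := 0) (d - r) (by linear_combination -hr), sgn_zero, one_mul]
      · rw [C.bdryForm_degree e d w v hw hv hde]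
        simp
    rw [mul_add, ← h]
    simp [B', parity_apply hv]
  have hdeg : FormHasDegree (shift 𝒱) (-1) B := fun d e v w hv hw h => by
    rw [hB _ _ _ hv, C.form_degree (d + 1) (e + 1) v w hv hw (by omega), mul_zero]
  have hanti : ∀ a b v w, v ∈ shift 𝒱 a → w ∈ shift 𝒱 b → B v w = -(sgn (a * b) * B w v) :=
    fun a b v w hv hw => by
      rw [hB _ _ _ hv, hB _ _ _ hw, C.form_symm _ _ _ _ hv hw, ← mul_assoc, ← mul_assoc,
        ← neg_mul, ← neg_one_mul, ← sgn_one, ← sgn_add, ← sgn_add, ← sgn_add]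
      congr 1
      exact sgn_congr a (by ring)
  have hdeg' : FormHasDegree (shift 𝒱') 0 B' := fun d e v w hv hw h => by
    rw [hB' _ _ _ _ hv hw, C.bdryForm_degree (d + 1) (e + 1) v w hv hw (by omega),
      C.bdryForm_degree (e + 1) (d + 1) w v hw hv (by omega)]
    simp
  have hB'' : ∀ a c X Y, X ∈ shift 𝒱' a → Y ∈ shift 𝒱' c →
      B' X Y = -(sgn a * C.bdryForm X Y) + sgn (a * c) * (sgn c * C.bdryForm Y X) :=
    fun a c X Y hX hY => by
      have h : sgn (a + 1) * sgn ((a + 1) * (c + 1)) = sgn (a * c) * sgn c := by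
        rw [← sgn_add, ← sgn_add]
        exact sgn_congr (a + 1) (by ring)
      rw [hB' _ _ _ _ hX hY, mul_add, ← mul_assoc (sgn (a + 1)), h, sgn_add a 1, sgn_one]
      ring
  have hanti' : ∀ a b v w, v ∈ shift 𝒱' a → w ∈ shift 𝒱' b → B' v w = -(sgn (a * b) * B' w v) :=
    fun a b v w hv hw => by
      rw [hB'' _ _ _ _ hv hw, hB'' _ _ _ _ hw hv, mul_comm b a]
      linear_combination (sgn a * C.bdryForm v w) * sgn_mul_self (a * b)
  have hω := constForm_hasValue B hdeg hanti
  have hω' := constForm_hasValue B' hdeg' hanti'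
  refine ⟨{
    Q := L.field
    Q_homological := field_isHomological L
    Q' := L'.field
    Q'_homological := field_isHomological L'
    Φ := π.map
    Φ_relates := map_relates π
    ω := constForm (-1) B hdeg hanti
    ω_closed := hω.isClosed
    ω' := constForm 0 B' hdeg' hanti'
    ω'_closed := hω'.isClosed
    lie_add_pullback := fun n a b d v w x hv hw hx =>
      lieDerivative_add_pullback_eq_zero hω hω' hB'' (fun m e y hy => ?_) hv hw hx
    lie' := fun n a b d v w x hv hw hx =>
      hω'.lieDerivative_eq_zero (fun m e y hy => ?_) hv hw hx },
    fun n d x hx => field_apply L hx, fun n d x hx => field_apply L' hx,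
    fun n d x hx => map_apply π hx, hω.isConstant, fun d v w x hv => ?_, hω'.isConstant,
    fun d e v w x hv hw => ?_⟩
  · have hyρ : Homog (shift 𝒱) (e ∘ finRotate (m + 2)) (y ∘ finRotate (m + 2)) := fun k => hy _
    rw [← sgn_bulkBracket π C.form C.bdryForm hB hyρ, ← sgn_bulkBracket π C.form C.bdryForm hB hy]
    exact (C.cyclic (m + 1)).rotate hy
  · have hyρ : Homog (shift 𝒱') (e ∘ finRotate (m + 2)) (y ∘ finRotate (m + 2)) := fun k => hy _
    rw [← sgn_boundaryBracket L' C.bdryForm hB' hyρ, ← sgn_boundaryBracket L' C.bdryForm hB' hy]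
    exact (C.bdry_cyclic (m + 1)).rotate hy
  · exact (hω 0 v w x).trans (hB d v w hv)
  · exact (hω' 0 v w x).trans (hB' d e v w hv hw)
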